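/- Let $f_1,\dots,f_n:\mathbb R^d\to\mathbb R$ ($n\ge1$) be differentiable with $\|\nabla f_i(x)-\nabla f_i(y)\|\le L\|x-y\|$ for all $x,y$, where $L>0$, and put $f=\frac1n\sum_{i=1}^n f_i$. Let $h:\mathbb R^d\to(-\infty,+\infty]$ be convex and proximable, i.e. for every $x\in\mathbb R^d$ and $s>0$ the function $y\mapsto h(y)+\frac1{2s}\|y-x\|^2$ has a minimizer, denoted $\mathrm{prox}_{sh}(x)$ (unique when $h\not\equiv+\infty$). Let $F=f+h$ attain its minimum, let $x_0\in\mathbb R^d$ with $F(x_0)<+\infty$, and write $\Delta_0=F(x_0)-\min F$. *Algorithm.* Let $m,b,\ell$ be positive integers with $\ell\le d$, let $\gamma>0$, $\beta_\tau>0$ for $\tau\ge 0$, and let $e_1,\dots,e_d$ be the canonical basis. Put $g(x,\beta)=\sum_{j=1}^d\frac{f(x+\beta e_j)-f(x)}{\beta}e_j$ and, for $G\in O(d)$, $\hat g_i(x,G,\beta)=\frac d\ell\sum_{j=1}^{\ell}\frac{f_i(x+\beta Ge_j)-f_i(x)}{\beta}Ge_j$. Start from $x_0^0=x_0$. For $\tau=0,1,\dots$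 and $k=0,\dots,m-1$ draw indices $i_{j,k}^\tau$ uniformly from $\{1,\dots,n\}$ and matrices $G_{j,k}^\tau$ from the normalized Haar measure on $O(d)$, $1\le j\le b$, all independent, and set $$v_k^\tau=\frac1b\sum_{j=1}^b\big(\hat g_{i_{j,k}^\tau}(x_k^\tau,G_{j,k}^\tau,\beta_\tau)-\hat g_{i_{j,k}^\tau}(x_0^\tau,G_{j,k}^\tau,\beta_\tau)\big)+g(x_0^\tau,\beta_\tau),\qquad x_{k+1}^\tau=\mathrm{prox}_{\gamma h}(x_k^\tau-\gamma v_k^\tau),$$ and $x_0^{\tau+1}=x_m^\tau$. With input $T$, the algorithm runs the outer loop for $\tau=0,\dots,T$ and outputs $x_0^T$; its complexity is the number of evaluations of values $f_i(x)$ that it performs. *Assumptions.* Let $\mathcal G_\gamma(x)=\frac1\gamma\big(x-\mathrm{prox}_{\gamma h}(x-\gamma\nabla f(x))\big)$. Suppose that for some $\mu>0$ the revised Polyak–Łojasiewicz (RPL) inequality $\|\mathcal G_\gamma(x)\|^2\ge2\mu(F(x)-\min F)$ holds for every $x$ with $F(x)<+\infty$. Put $\alpha=1-\frac{\gamma\mu}2$,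 $\theta=1-\frac{\mu\gamma}2-\mu\gamma m$ and $$\bar C=\frac2\mu\Big[\frac{3L^2d^2}{\ell}+\frac{L^2d}{2}\Big],$$ and suppose $$\gamma<\min\Big\{\frac1{4L},\ \frac2\mu\,\frac1{2m+1},\ \frac{\sqrt{b\theta}}{10mL}\sqrt{\frac\ell d}\Big\}.$$ *Conclusions.* In each of the following bounds $F$ is almost surely finite at the iterate and the expectation exists. (i) If $\beta_\tau=\alpha^{m(\tau+1)/2}\eta_\tau$ with $\eta_\tau>0$ and $\sum_{i=0}^\infty\eta_i^2\le\tilde C<+\infty$, then for every $\tau\ge0$ $$\mathbb E[F(x_0^{\tau+1})-\min F]\le\alpha^{m(\tau+1)}\Big(\Delta_0+\frac2\mu\Big[\frac{3L^2d^2}{\ell}+\frac{L^2d}{2}\Big]\tilde C\Big).$$ (ii) If $\beta_\tau=\beta>0$ for all $\tau$, then for every $\tau\ge0$ $$\mathbb E[F(x_0^{\tau+1})-\min F]\le\alpha^{m(\tau+1)}\Delta_0+\bar C\beta^2.$$ (iii) For every $\varepsilon_0\in(0,1)$ there are constants $K,K'>0$ that depend only on $\varepsilon_0$ and $\Delta_0$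 (not on $\varepsilon,n,d,b,\ell,m,\gamma,\mu,L$ nor otherwise on the functions) such that for every $\varepsilon\in(0,\varepsilon_0]$, with $\beta_\tau=\sqrt{\varepsilon/(2\bar C)}$ for all $\tau$: every integer $T\ge K\,\frac1{m\gamma\mu}\log\frac1\varepsilon$ satisfies $$\mathbb E[F(x_0^T)-\min F]\le\varepsilon,$$ and for the smallest such integer $T=\big\lceil K\frac1{m\gamma\mu}\log\frac1\varepsilon\big\rceil$ the algorithm performs at most $$K'\Big(\frac{nd}{\gamma\mu m}+\frac{b\ell}{\gamma\mu}\Big)\log\frac1\varepsilon$$ evaluations of functions $f_i$. -/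

import Mathlib

open MeasureTheory ProbabilityTheory

noncomputable section

namespace VRSZD

/-- The Euclidean space `ℝ^d`. -/
abbrev E (d : ℕ) : Type := EuclideanSpace ℝ (Fin d)

/-- The orthogonal group `O(d)`. -/
abbrev OGroup (d : ℕ) : Type := Matrix.orthogonalGroup (Fin d) ℝ

instance (d : ℕ) : MeasurableSpace (OGroup d) := borel _

instance (d : ℕ) : BorelSpace (OGroup d) := ⟨rfl⟩

/-- The `j`-th vector of the canonical basis. -/
def basisVec {d : ℕ} (j : Fin d) : E d := EuclideanSpace.single j 1

/-- The image `G e_j` of the `j`-th canonical basis vector under an orthogonal matrix `G`. -/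
def dirVec {d : ℕ} (G : OGroup d) (j : Fin d) : E d :=
  WithLp.toLp 2 ((G : Matrix (Fin d) (Fin d) ℝ).mulVec (basisVec j).ofLp)

section Problem

variable {d n : ℕ}

/-- The finite sum `f = (1/n) ∑ i, f_i`. -/
def avg (f : Fin n → E d → ℝ) (x : E d) : ℝ := (1 / (n : ℝ)) * ∑ i, f i x

/-- The objective `F = f + h`; the regularizer `h`, hence `F`, may take the value `+∞`. -/
def objective (f : Fin n → E d → ℝ) (h : E d → EReal) (x : E d) : EReal :=
  ((avg f x : ℝ) : EReal) + h x

/-- `min F` as a real number: the infimum in the complete lattice `EReal`, used only when it is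
attained and finite. -/
def minValue (f : Fin n → E d → ℝ) (h : E d → EReal) : ℝ := (⨅ x, objective f h x).toReal

/-- The optimality gap `F(x) - min F`, used only at points where `F` is finite. -/
def gap (f : Fin n → E d → ℝ) (h : E d → EReal) (x : E d) : ℝ :=
  (objective f h x).toReal - minValue f h

/-- `L`-smoothness of each `f_i`. -/
def IsSmoothFamily (f : Fin n → E d → ℝ) (L : ℝ) : Prop :=
  ∀ i, Differentiable ℝ (f i) ∧ ∀ x y, ‖gradient (f i) x - gradient (f i) y‖ ≤ L * ‖x - y‖

/-- A convex function with values in `(-∞, +∞]`: it is convex on its effective domain, which is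
a convex set. -/
def IsConvexExt (h : E d → EReal) : Prop :=
  (∀ x, h x ≠ ⊥) ∧ ConvexOn ℝ {x | h x ≠ ⊤} (fun x => (h x).toReal)

/-- `p` minimizes `y ↦ h y + ‖y - x‖² / (2γ)`. -/
def IsProx (h : E d → EReal) (γ : ℝ) (x p : E d) : Prop :=
  ∀ y, h p + ((1 / (2 * γ) * ‖p - x‖ ^ 2 : ℝ) : EReal)
    ≤ h y + ((1 / (2 * γ) * ‖y - x‖ ^ 2 : ℝ) : EReal)

/-- The minimization problems that define the proximal operators of `h` have solutions. -/
def IsProximable (h : E d → EReal) : Prop :=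
  ∀ γ : ℝ, 0 < γ → ∀ x, ∃ p, IsProx h γ x p

/-- The proximal operator `prox_{γ h}`. For proximable, convex, proper `h` and `γ > 0` the
minimizer is unique, so that nothing is chosen. -/
def prox (h : E d → EReal) (γ : ℝ) (x : E d) : E d := Classical.epsilon (IsProx h γ x)

/-- The gradient mapping `(1/γ) (x - prox_{γ h} (x - γ ∇f(x)))`. -/
def gradMap (f : Fin n → E d → ℝ) (h : E d → EReal) (γ : ℝ) (x : E d) : E d :=
  (1 / γ) • (x - prox h γ (x - γ • gradient (avg f) x))

/-- The revised Polyak–Łojasiewicz condition with constant `μ` and stepsize `γ`, required at the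
points where `F` is finite. -/
def IsRPL (f : Fin n → E d → ℝ) (h : E d → EReal) (γ μ : ℝ) : Prop :=
  ∀ x, objective f h x ≠ ⊤ → 2 * μ * gap f h x ≤ ‖gradMap f h γ x‖ ^ 2

end Problem

section Algorithm

variable {d n b : ℕ}

/-- Forward finite differences of `f` along the canonical basis. -/
def fullApprox (f : Fin n → E d → ℝ) (β : ℝ) (x : E d) : E d :=
  ∑ j : Fin d, ((avg f (x + β • basisVec j) - avg f x) / β) • basisVec j

/-- Forward finite differences of `f_i` along the first `ℓ` columns of `G`, scaled by `d/ℓ`. -/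
def stochApprox (f : Fin n → E d → ℝ) (ℓ : ℕ) (β : ℝ) (i : Fin n) (G : OGroup d) (x : E d) :
    E d :=
  ((d : ℝ) / ℓ) • ∑ j : Fin d with j.val < ℓ,
    ((f i (x + β • dirVec G j) - f i x) / β) • dirVec G j

/-- The search direction at the inner iterate `x`, with outer iterate `x₀`, discretization `β`
and sampled batch `ξ` of indices and orthogonal matrices. -/
def searchDir (f : Fin n → E d → ℝ) (ℓ : ℕ) (β : ℝ) (ξ : Fin b → Fin n × OGroup d)
    (x₀ x : E d) : E d :=
  (1 / (b : ℝ)) • ∑ j : Fin b, (stochApprox f ℓ β (ξ j).1 (ξ j).2 x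
      - stochApprox f ℓ β (ξ j).1 (ξ j).2 x₀)
    + fullApprox f β x₀

/-- The inner iterates `x_k` started at the outer iterate `x₀`; the batch of step `k` is `ξ k`. -/
def innerIter (f : Fin n → E d → ℝ) (h : E d → EReal) (γ : ℝ) (ℓ : ℕ) (β : ℝ)
    (ξ : ℕ → Fin b → Fin n × OGroup d) (x₀ : E d) : ℕ → E d
  | 0 => x₀
  | k + 1 => prox h γ (innerIter f h γ ℓ β ξ x₀ k
      - γ • searchDir f ℓ β (ξ k) x₀ (innerIter f h γ ℓ β ξ x₀ k))

/-- The outer iterates `x_0^τ`; `ξ τ k` is the batch of inner step `k` of outer iteration `τ`. -/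
def outerIter (f : Fin n → E d → ℝ) (h : E d → EReal) (γ : ℝ) (ℓ m : ℕ) (β : ℕ → ℝ)
    (ξ : ℕ → ℕ → Fin b → Fin n × OGroup d) (x₀ : E d) : ℕ → E d
  | 0 => x₀
  | τ + 1 => innerIter f h γ ℓ (β τ) (ξ τ) (outerIter f h γ ℓ m β ξ x₀ τ) m

end Algorithm

section Sampling

variable {d n b : ℕ} {Ω : Type*} [MeasurableSpace Ω]

/-- The random variables drawn by the algorithm: indices uniform on `{1, …, n}` and matrices
uniform on `O(d)` (distributed according to the normalized Haar measure), all independent. -/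
structure IsSampling (P : Measure Ω) (I : ℕ → ℕ → Fin b → Ω → Fin n)
    (G : ℕ → ℕ → Fin b → Ω → OGroup d) : Prop where
  measurable_index : ∀ τ k j, Measurable (I τ k j)
  measurable_matrix : ∀ τ k j, Measurable (G τ k j)
  uniform_index : ∀ τ k j i, P {ω | I τ k j ω = i} = (n : ENNReal)⁻¹
  haar_matrix : ∀ τ k j, (P.map (G τ k j)).IsHaarMeasure
  indep_index_matrix : ∀ τ k j, IndepFun (I τ k j) (G τ k j) P
  indep_draws : iIndepFun
    (fun (s : ℕ × ℕ × Fin b) (ω : Ω) => (I s.1 s.2.1 s.2.2 ω, G s.1 s.2.1 s.2.2 ω)) P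

/-- The realization of all draws at the outcome `ω`. -/
def draws (I : ℕ → ℕ → Fin b → Ω → Fin n) (G : ℕ → ℕ → Fin b → Ω → OGroup d) (ω : Ω) :
    ℕ → ℕ → Fin b → Fin n × OGroup d :=
  fun τ k j => (I τ k j ω, G τ k j ω)

/-- `𝔼[F(X) - min F] ≤ B`, including that `F(X)` is almost surely finite and that the
expectation exists. -/
def ExpectedGapLE (P : Measure Ω) (f : Fin n → E d → ℝ) (h : E d → EReal) (X : Ω → E d)
    (B : ℝ) : Prop :=
  (∀ᵐ ω ∂P, objective f h (X ω) ≠ ⊤) ∧ Integrable (fun ω => gap f h (X ω)) P ∧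
    ∫ ω, gap f h (X ω) ∂P ≤ B

end Sampling

/-! The cost model: a program has no access to the functions `f_i` other than by queries
"evaluate `f_i` at `x`", and its cost is the number of queries. -/

/-- Programs that may query values `f_i(x)` and return an element of `α`. -/
inductive Prog (n d : ℕ) (α : Type) : Type
  | ret : α → Prog n d α
  | query : Fin n → E d → (ℝ → Prog n d α) → Prog n d α

namespace Prog

variable {n d b : ℕ} {α β : Type}

/-- Sequential composition. -/
def andThen : Prog n d α → (α → Prog n d β) → Prog n d β
  | ret a, q => q a
  | query i x k, q => query i x fun r => andThen (k r) q

instance : Monad (Prog n d) where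
  pure := ret
  bind := andThen

/-- The value returned when queries are answered by the functions `f_i`. -/
def run (f : Fin n → E d → ℝ) : Prog n d α → α
  | ret a => a
  | query i x k => run f (k (f i x))

/-- The number of function evaluations performed. -/
def evals (f : Fin n → E d → ℝ) : Prog n d α → ℕ
  | ret _ => 0
  | query i x k => evals f (k (f i x)) + 1

/-- A single function evaluation `f_i(x)`. -/
def eval (i : Fin n) (x : E d) : Prog n d ℝ := query i x ret

/-- Run a program for each entry of a list and add up the results. -/
def sumOver {ι : Type} [AddMonoid α] : List ι → (ι → Prog n d α) → Prog n d α
  | [], _ => ret 0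
  | a :: l, p => do
      let u ← p a
      let w ← sumOver l p
      return u + w

/-- Evaluate the full finite sum `f(x)`. -/
def evalAvg (x : E d) : Prog n d ℝ := do
  let s ← sumOver (List.finRange n) fun i => eval i x
  return (1 / (n : ℝ)) * s

/-- The full surrogate of the gradient. -/
def fullApprox (β : ℝ) (x : E d) : Prog n d (E d) := do
  let c ← evalAvg x
  sumOver (List.finRange d) fun j => do
    let v ← evalAvg (x + β • basisVec j)
    return ((v - c) / β) • basisVec j

/-- The structured stochastic surrogate of the gradient. -/
def stochApprox (ℓ : ℕ) (β : ℝ) (i : Fin n) (G : OGroup d) (x : E d) : Prog n d (E d) := do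
  let c ← eval i x
  let s ← sumOver ((List.finRange d).filter fun j => j.val < ℓ) fun j => do
    let v ← eval i (x + β • dirVec G j)
    return ((v - c) / β) • dirVec G j
  return ((d : ℝ) / ℓ) • s

/-- The first `k` inner steps from `x₀`, with full surrogate `g`. -/
def inner (h : E d → EReal) (γ : ℝ) (ℓ : ℕ) (β : ℝ) (ξ : ℕ → Fin b → Fin n × OGroup d)
    (g x₀ : E d) : ℕ → Prog n d (E d)
  | 0 => return x₀
  | k + 1 => do
      let x ← inner h γ ℓ β ξ g x₀ k
      let s ← sumOver (List.finRange b) fun j => do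
        let u ← stochApprox ℓ β (ξ k j).1 (ξ k j).2 x
        let w ← stochApprox ℓ β (ξ k j).1 (ξ k j).2 x₀
        return u - w
      return prox h γ (x - γ • ((1 / (b : ℝ)) • s + g))

/-- One outer iteration. -/
def outerStep (h : E d → EReal) (γ : ℝ) (ℓ m : ℕ) (β : ℝ) (ξ : ℕ → Fin b → Fin n × OGroup d)
    (x₀ : E d) : Prog n d (E d) := do
  let g ← fullApprox β x₀
  inner h γ ℓ β ξ g x₀ m

/-- The first `τ` outer iterations. -/
def outer (h : E d → EReal) (γ : ℝ) (ℓ m : ℕ) (β : ℕ → ℝ)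
    (ξ : ℕ → ℕ → Fin b → Fin n × OGroup d) (x₀ : E d) : ℕ → Prog n d (E d)
  | 0 => return x₀
  | τ + 1 => do
      let x ← outer h γ ℓ m β ξ x₀ τ
      outerStep h γ ℓ m (β τ) (ξ τ) x

/-- The whole algorithm: the outer loop runs over `τ = 0, …, T`, and `x_0^T` is returned. -/
def vrszd (h : E d → EReal) (γ : ℝ) (ℓ m : ℕ) (β : ℕ → ℝ)
    (ξ : ℕ → ℕ → Fin b → Fin n × OGroup d) (x₀ : E d) (T : ℕ) : Prog n d (E d) := do
  let x ← outer h γ ℓ m β ξ x₀ T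
  let _ ← outerStep h γ ℓ m (β T) (ξ T) x
  return x

theorem run_bind (f : Fin n → E d → ℝ) (p : Prog n d α) (q : α → Prog n d β) :
    (p >>= q).run f = (q (p.run f)).run f := by
  change (andThen p q).run f = _
  induction p with
  | ret a => rfl
  | query i x k ih => exact ih _

theorem run_pure (f : Fin n → E d → ℝ) (a : α) : (pure a : Prog n d α).run f = a := rfl

theorem run_sumOver {ι : Type} [AddMonoid α] (f : Fin n → E d → ℝ) (l : List ι)
    (p : ι → Prog n d α) : (sumOver l p).run f = (l.map fun a => (p a).run f).sum := by
  induction l with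
  | nil => rfl
  | cons a l ih => simp [sumOver, run_bind, run_pure, ih]

theorem run_evalAvg (f : Fin n → E d → ℝ) (x : E d) : (evalAvg x).run f = avg f x := by
  simp [evalAvg, run_bind, run_pure, run_sumOver, avg, eval, run, List.sum_ofFn,
    ← List.ofFn_eq_map]

theorem run_fullApprox (f : Fin n → E d → ℝ) (β : ℝ) (x : E d) :
    (fullApprox β x).run f = VRSZD.fullApprox f β x := by
  simp [fullApprox, run_bind, run_pure, run_sumOver, run_evalAvg, VRSZD.fullApprox,
    List.sum_ofFn, ← List.ofFn_eq_map]

theorem run_stochApprox (f : Fin n → E d → ℝ) (ℓ : ℕ) (β : ℝ) (i : Fin n) (G : OGroup d)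
    (x : E d) : (stochApprox ℓ β i G x).run f = VRSZD.stochApprox f ℓ β i G x := by
  simp only [stochApprox, run_bind, run_pure, run_sumOver, eval, run, VRSZD.stochApprox]
  congr 1

theorem run_inner (f : Fin n → E d → ℝ) (h : E d → EReal) (γ : ℝ) (ℓ : ℕ) (β : ℝ)
    (ξ : ℕ → Fin b → Fin n × OGroup d) (x₀ : E d) (k : ℕ) :
    (inner h γ ℓ β ξ (VRSZD.fullApprox f β x₀) x₀ k).run f = innerIter f h γ ℓ β ξ x₀ k := by
  induction k with
  | zero => rfl
  | succ k ih =>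
    simp [inner, run_bind, run_pure, run_sumOver, run_stochApprox, ih, innerIter, searchDir,
      List.sum_ofFn, ← List.ofFn_eq_map]

theorem run_outer (f : Fin n → E d → ℝ) (h : E d → EReal) (γ : ℝ) (ℓ m : ℕ) (β : ℕ → ℝ)
    (ξ : ℕ → ℕ → Fin b → Fin n × OGroup d) (x₀ : E d) (τ : ℕ) :
    (outer h γ ℓ m β ξ x₀ τ).run f = outerIter f h γ ℓ m β ξ x₀ τ := by
  induction τ with
  | zero => rfl
  | succ τ ih =>
    simp [outer, outerStep, run_bind, ih, run_fullApprox, run_inner, outerIter]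

/-- The program returns the outer iterate `x_0^T`. -/
theorem run_vrszd (f : Fin n → E d → ℝ) (h : E d → EReal) (γ : ℝ) (ℓ m : ℕ) (β : ℕ → ℝ)
    (ξ : ℕ → ℕ → Fin b → Fin n × OGroup d) (x₀ : E d) (T : ℕ) :
    (vrszd h γ ℓ m β ξ x₀ T).run f = outerIter f h γ ℓ m β ξ x₀ T := by
  simp [vrszd, run_bind, run_pure, run_outer]

end Prog

/-- The contraction factor `α = 1 - γ μ / 2`. -/
def rate (γ μ : ℝ) : ℝ := 1 - γ * μ / 2

/-- The quantity `θ = 1 - μ γ / 2 - μ γ m`. -/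
def theta (γ μ : ℝ) (m : ℕ) : ℝ := 1 - μ * γ / 2 - μ * γ * m

/-- The constant `(2/μ) (3 L² d² / ℓ + L² d / 2)`. -/
def errConst (L μ : ℝ) (d ℓ : ℕ) : ℝ :=
  2 / μ * (3 * L ^ 2 * (d : ℝ) ^ 2 / ℓ + L ^ 2 * d / 2)

end VRSZD

end

/-!
By the RPL inequality the exact step `prox_{γh}(x - γ∇f(x))` contracts the gap. Comparing a step
`x⁺` in a direction `v` with the exact one shows that it still contracts the gap by the factor
`α = 1 - γμ/2`, up to an error `γ/2 ‖v - ∇f(x)‖²` and with an additional gain `3/(8γ) ‖x⁺ - x‖²`.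

Finite differences agree with directional derivatives up to `O(β)`, so that up to a bias of squared
size `O(β²)` the error of `v` is that of an average of sketches `(d/ℓ) ∑_{j ≤ ℓ} ⟪G e_j, w⟫ G e_j`
of the differences `w = ∇f_i(x) - ∇f_i(x₀)`. The Haar measure is invariant under sign changes and
permutations of the coordinates, hence a sketch is unbiased with second moment `(d/ℓ) ‖w‖²`, and
the average over an independent batch has variance `O(‖x - x₀‖²)`. By the stepsize restriction the
gains `‖x_{k+1} - x_k‖²` of a whole inner loop pay for these variances; what is left is a
contraction by `α^m` up to the bias.
-/

namespace VRSZD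

/-! ### Smooth functions -/

theorem abs_sub_sub_inner_gradient_le {V : Type*} [NormedAddCommGroup V] [InnerProductSpace ℝ V]
    [CompleteSpace V] {f : V → ℝ} {L : ℝ} (hf : Differentiable ℝ f)
    (hL : ∀ x y, ‖gradient f x - gradient f y‖ ≤ L * ‖x - y‖) (x y : V) :
    |f y - f x - inner ℝ (gradient f x) (y - x)| ≤ L / 2 * ‖y - x‖ ^ 2 := by
  set u := y - x with hu
  -- compare the remainder along the segment with `t ↦ (L / 2) ‖u‖² t²`, whose derivative
  -- dominates that of the remainder
  let φ : ℝ → ℝ := fun t => f (x + t • u) - f x - t * inner ℝ (gradient f x) u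
  have hφ : ∀ t, HasDerivAt φ (inner ℝ (gradient f (x + t • u) - gradient f x) u) t := fun t => by
    have hline : HasDerivAt (fun t : ℝ => x + t • u) u t := by
      simpa using ((hasDerivAt_id t).smul_const u).const_add x
    have hcomp := (hf (x + t • u)).hasGradientAt.hasFDerivAt.comp_hasDerivAt t hline
    refine ((hcomp.sub_const (f x)).sub
      ((hasDerivAt_id t).mul_const (inner ℝ (gradient f x) u))).congr_deriv ?_
    simp [inner_sub_left]
  have hB : ∀ t : ℝ, HasDerivAt (fun t : ℝ => L / 2 * ‖u‖ ^ 2 * t ^ 2) (L * ‖u‖ ^ 2 * t) t :=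
    fun t => ((hasDerivAt_pow 2 t).const_mul (L / 2 * ‖u‖ ^ 2)).congr_deriv (by push_cast; ring)
  have hbound : ∀ t ∈ Set.Ico (0 : ℝ) 1,
      ‖inner ℝ (gradient f (x + t • u) - gradient f x) u‖ ≤ L * ‖u‖ ^ 2 * t := fun t ht => by
    calc ‖inner ℝ (gradient f (x + t • u) - gradient f x) u‖
        ≤ ‖gradient f (x + t • u) - gradient f x‖ * ‖u‖ := norm_inner_le_norm _ _
      _ ≤ L * ‖x + t • u - x‖ * ‖u‖ := by gcongr; exact hL _ _
      _ = L * ‖u‖ ^ 2 * t := by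
        rw [add_sub_cancel_left, norm_smul, Real.norm_of_nonneg ht.1]; ring
  have key := image_norm_le_of_norm_deriv_right_le_deriv_boundary (f := φ) (a := 0) (b := 1)
    (fun t _ => (hφ t).continuousAt.continuousWithinAt)
    (fun t _ => (hφ t).hasDerivWithinAt) (by simp [φ]) hB hbound
    (Set.right_mem_Icc.2 zero_le_one)
  simpa [φ, hu] using key

theorem norm_inv_smul_sum_le {V : Type*} [SeminormedAddCommGroup V] [NormedSpace ℝ V] {n : ℕ}
    (hn : 0 < n) {w : Fin n → V} {c : ℝ} (hw : ∀ i, ‖w i‖ ≤ c) :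
    ‖(1 / (n : ℝ)) • ∑ i, w i‖ ≤ c := by
  have hn' : (0 : ℝ) < n := Nat.cast_pos.2 hn
  have hsum : ‖∑ i, w i‖ ≤ n * c := by
    simpa using norm_sum_le_of_le Finset.univ fun i _ => hw i
  rw [norm_smul, Real.norm_of_nonneg (by positivity), one_div, inv_mul_le_iff₀ hn']
  exact hsum

section Average

variable {d n : ℕ} {f : Fin n → E d → ℝ} {L : ℝ}

theorem hasGradientAt_avg (hf : ∀ i, Differentiable ℝ (f i)) (x : E d) :
    HasGradientAt (avg f) ((1 / (n : ℝ)) • ∑ i, gradient (f i) x) x := by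
  rw [hasGradientAt_iff_hasFDerivAt, map_smulₛₗ, map_sum]
  exact (HasFDerivAt.fun_sum fun i _ => (hf i x).hasGradientAt.hasFDerivAt).const_mul _

namespace IsSmoothFamily

theorem differentiable (hf : IsSmoothFamily f L) (i : Fin n) : Differentiable ℝ (f i) := (hf i).1

theorem differentiable_avg (hf : IsSmoothFamily f L) : Differentiable ℝ (avg f) := fun x =>
  (hasGradientAt_avg hf.differentiable x).differentiableAt

theorem gradient_avg (hf : IsSmoothFamily f L) (x : E d) :
    gradient (avg f) x = (1 / (n : ℝ)) • ∑ i, gradient (f i) x :=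
  (hasGradientAt_avg hf.differentiable x).gradient

theorem norm_gradient_avg_sub_le (hn : 0 < n) (hf : IsSmoothFamily f L) (x y : E d) :
    ‖gradient (avg f) x - gradient (avg f) y‖ ≤ L * ‖x - y‖ := by
  rw [hf.gradient_avg, hf.gradient_avg, ← smul_sub, ← Finset.sum_sub_distrib]
  exact norm_inv_smul_sum_le hn fun i => (hf i).2 x y

theorem continuous_gradient_avg (hn : 0 < n) (hf : IsSmoothFamily f L) :
    Continuous (gradient (avg f)) :=
  (LipschitzWith.of_dist_le_mul (K := L.toNNReal) fun x y => by
    rw [dist_eq_norm, dist_eq_norm]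
    exact (hf.norm_gradient_avg_sub_le hn x y).trans <| by
      gcongr; exact L.le_coe_toNNReal).continuous

end IsSmoothFamily

end Average

/-! ### The proximal operator -/

section Prox

variable {d : ℕ} {h : E d → EReal} {γ : ℝ}

namespace IsProx

variable {x p y : E d}

theorem ne_top (hp : IsProx h γ x p) (hy : h y ≠ ⊤) : h p ≠ ⊤ := by
  intro htop
  have hle := hp y
  rw [htop, EReal.top_add_coe, top_le_iff] at hle
  exact EReal.add_ne_top hy (EReal.coe_ne_top _) hle

theorem toReal_add_le (hbot : ∀ x, h x ≠ ⊥) (hp : IsProx h γ x p) (hy : h y ≠ ⊤) :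
    (h p).toReal + 1 / (2 * γ) * ‖p - x‖ ^ 2 ≤ (h y).toReal + 1 / (2 * γ) * ‖y - x‖ ^ 2 := by
  have hle := hp y
  rw [← EReal.coe_toReal (hp.ne_top hy) (hbot p), ← EReal.coe_toReal hy (hbot y)] at hle
  exact_mod_cast hle

theorem toReal_add_inner_le_of_segment (hconv : IsConvexExt h) (hp : IsProx h γ x p)
    (hy : h y ≠ ⊤) {t : ℝ} (ht : 0 < t) (ht1 : t ≤ 1) :
    (h p).toReal + 1 / γ * inner ℝ (x - p) (y - p)
      ≤ (h y).toReal + 1 / (2 * γ) * t * ‖y - p‖ ^ 2 := by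
  have hpt := hp.ne_top hy
  have hseg : (h ((1 - t) • p + t • y)).toReal ≤ (1 - t) * (h p).toReal + t * (h y).toReal :=
    hconv.2.2 hpt hy (sub_nonneg.2 ht1) ht.le (by ring)
  have hmin := hp.toReal_add_le hconv.1 (hconv.2.1 hpt hy (sub_nonneg.2 ht1) ht.le (by ring))
  have hexpand : ‖(1 - t) • p + t • y - x‖ ^ 2
      = ‖p - x‖ ^ 2 - 2 * t * inner ℝ (x - p) (y - p) + t ^ 2 * ‖y - p‖ ^ 2 := by
    rw [show (1 - t) • p + t • y - x = (p - x) + t • (y - p) by module, norm_add_sq_real,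
      norm_smul, inner_smul_right, mul_pow, Real.norm_eq_abs, sq_abs, ← neg_sub x p,
      inner_neg_left]
    ring
  refine le_of_mul_le_mul_left ?_ ht
  rw [hexpand] at hmin
  calc t * ((h p).toReal + 1 / γ * inner ℝ (x - p) (y - p))
      = t * (h p).toReal + 1 / (2 * γ) * (2 * t * inner ℝ (x - p) (y - p)) := by
        ring
    _ ≤ t * (h y).toReal + 1 / (2 * γ) * (t ^ 2 * ‖y - p‖ ^ 2) := by linarith
    _ = t * ((h y).toReal + 1 / (2 * γ) * t * ‖y - p‖ ^ 2) := by ring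

theorem toReal_add_inner_le (hconv : IsConvexExt h) (hp : IsProx h γ x p) (hy : h y ≠ ⊤) :
    (h p).toReal + 1 / γ * inner ℝ (x - p) (y - p) ≤ (h y).toReal := by
  have hlim : Filter.Tendsto (fun t : ℝ => (h y).toReal + 1 / (2 * γ) * t * ‖y - p‖ ^ 2)
      (nhdsWithin 0 (Set.Ioi 0)) (nhds (h y).toReal) :=
    (Continuous.tendsto' (by fun_prop) _ _ (by simp)).mono_left nhdsWithin_le_nhds
  refine ge_of_tendsto hlim ?_
  filter_upwards [Ioc_mem_nhdsGT zero_lt_one] with t ht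
  exact hp.toReal_add_inner_le_of_segment hconv hy ht.1 ht.2

theorem norm_sq_sub_le_inner {x' p' : E d} (hconv : IsConvexExt h) (hγ : 0 < γ)
    (hp : IsProx h γ x p) (hp' : IsProx h γ x' p') (hy : h y ≠ ⊤) :
    ‖p - p'‖ ^ 2 ≤ inner ℝ (x - x') (p - p') := by
  have hle := hp.toReal_add_inner_le hconv (hp'.ne_top hy)
  have hle' := hp'.toReal_add_inner_le hconv (hp.ne_top hy)
  have hsum : inner ℝ (x - p) (p' - p) + inner ℝ (x' - p') (p - p') ≤ 0 :=
    nonpos_of_mul_nonpos_right (by linarith : 1 / γ * _ ≤ 0) (one_div_pos.2 hγ)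
  have hsplit : inner ℝ (x - p) (p' - p) + inner ℝ (x' - p') (p - p')
      = ‖p - p'‖ ^ 2 - inner ℝ (x - x') (p - p') := by
    rw [← real_inner_self_eq_norm_sq]
    simp only [inner_sub_left, inner_sub_right]
    ring
  linarith

end IsProx

theorem isProx_prox (hprox : IsProximable h) (hγ : 0 < γ) (x : E d) :
    IsProx h γ x (prox h γ x) :=
  Classical.epsilon_spec (hprox γ hγ x)

variable {z : E d}

theorem prox_ne_top (hprox : IsProximable h) (hγ : 0 < γ) (hz : h z ≠ ⊤) (x : E d) :
    h (prox h γ x) ≠ ⊤ :=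
  (isProx_prox hprox hγ x).ne_top hz

variable (hconv : IsConvexExt h) (hprox : IsProximable h) (hγ : 0 < γ) (hz : h z ≠ ⊤)

include hconv hprox hγ hz

theorem norm_prox_sub_prox_le (x y : E d) : ‖prox h γ x - prox h γ y‖ ≤ ‖x - y‖ := by
  have hfirm := (isProx_prox hprox hγ x).norm_sq_sub_le_inner hconv hγ
    (isProx_prox hprox hγ y) hz
  have hcs := real_inner_le_norm (x - y) (prox h γ x - prox h γ y)
  by_contra! hlt
  nlinarith [norm_nonneg (x - y)]

theorem continuous_prox : Continuous (prox h γ) :=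
  (LipschitzWith.of_dist_le_mul (K := 1) fun x y => by
    simpa [dist_eq_norm] using norm_prox_sub_prox_le hconv hprox hγ hz x y).continuous

-- `h` itself need not be measurable; along proximal points the subgradient inequality squeezes it
theorem continuous_toReal_prox : Continuous fun x => (h (prox h γ x)).toReal := by
  have hc := continuous_prox hconv hprox hγ hz
  have hle : ∀ x y, (h (prox h γ x)).toReal
      + 1 / γ * inner ℝ (x - prox h γ x) (prox h γ y - prox h γ x) ≤ (h (prox h γ y)).toReal :=
    fun x y => (isProx_prox hprox hγ x).toReal_add_inner_le hconv (prox_ne_top hprox hγ hz y)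
  refine continuous_iff_continuousAt.2 fun x => ?_
  refine tendsto_of_tendsto_of_tendsto_of_le_of_le
    (h := fun y => (h (prox h γ x)).toReal
      - 1 / γ * inner ℝ (y - prox h γ y) (prox h γ x - prox h γ y)) ?_ ?_
    (hle x) (fun y => le_sub_iff_add_le.2 (hle y x))
  · exact Continuous.tendsto' (by fun_prop) _ _ (by simp)
  · exact Continuous.tendsto' (by fun_prop) _ _ (by simp)

end Prox

/-! ### One proximal step -/

section Step

variable {d n : ℕ} {f : Fin n → E d → ℝ} {h : E d → EReal} {γ μ L : ℝ}

theorem objective_ne_top_iff {x : E d} : objective f h x ≠ ⊤ ↔ h x ≠ ⊤ := by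
  refine ⟨fun hx hh => hx ?_, fun hx => EReal.add_ne_top (EReal.coe_ne_top _) hx⟩
  rw [objective, hh, EReal.coe_add_top]

theorem gap_eq {x : E d} (hconv : IsConvexExt h) (hx : h x ≠ ⊤) :
    gap f h x = avg f x + (h x).toReal - minValue f h := by
  rw [gap, objective, EReal.toReal_add (EReal.coe_ne_top _) (EReal.coe_ne_bot _) hx (hconv.1 x),
    EReal.toReal_coe]

theorem gap_nonneg {x z : E d} (hconv : IsConvexExt h)
    (hz : ∀ x, objective f h z ≤ objective f h x) (hx : h x ≠ ⊤) : 0 ≤ gap f h x := by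
  have hinf : ⨅ y, objective f h y = objective f h z :=
    le_antisymm (iInf_le _ _) (le_iInf hz)
  rw [gap, minValue, hinf, sub_nonneg]
  refine EReal.toReal_le_toReal (hz x) ?_ (objective_ne_top_iff.2 hx)
  rw [objective, Ne, EReal.add_eq_bot_iff]
  simp [hconv.1 z]

theorem inner_le_add_norm_sq {V : Type*} [NormedAddCommGroup V] [InnerProductSpace ℝ V]
    (hγ : 0 < γ) (u v : V) : inner ℝ u v ≤ γ / 2 * ‖u‖ ^ 2 + 1 / (2 * γ) * ‖v‖ ^ 2 := by
  have hsq : 0 ≤ 1 / (2 * γ) * (‖v‖ - γ * ‖u‖) ^ 2 := by positivity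
  have hexpand : 1 / (2 * γ) * (‖v‖ - γ * ‖u‖) ^ 2
      = γ / 2 * ‖u‖ ^ 2 + 1 / (2 * γ) * ‖v‖ ^ 2 - ‖u‖ * ‖v‖ := by field_simp; ring
  linarith [real_inner_le_norm u v]

variable (hconv : IsConvexExt h) (hprox : IsProximable h) (hγ : 0 < γ)

include hconv hprox hγ

theorem continuous_gap_prox (hf : IsSmoothFamily f L) {z : E d} (hz : h z ≠ ⊤) :
    Continuous fun x => gap f h (prox h γ x) := by
  simp only [gap_eq hconv (prox_ne_top hprox hγ hz _)]
  exact ((hf.differentiable_avg.continuous.comp (continuous_prox hconv hprox hγ hz)).add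
    (continuous_toReal_prox hconv hprox hγ hz)).sub continuous_const

variable (hn : 0 < n) (hf : IsSmoothFamily f L)

include hn hf

theorem gap_prox_le {x v z : E d} (hz : h z ≠ ⊤) :
    gap f h (prox h γ (x - γ • v)) ≤ gap f h z
      + inner ℝ (gradient (avg f) x - v) (prox h γ (x - γ • v) - z)
      + (L / 2 - 1 / (2 * γ)) * ‖prox h γ (x - γ • v) - x‖ ^ 2
      + (L / 2 + 1 / (2 * γ)) * ‖z - x‖ ^ 2
      - 1 / (2 * γ) * ‖prox h γ (x - γ • v) - z‖ ^ 2 := by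
  have hsub := (isProx_prox hprox hγ (x - γ • v)).toReal_add_inner_le hconv hz
  have hp := prox_ne_top hprox hγ hz (x - γ • v)
  set p := prox h γ (x - γ • v)
  have hsmooth := abs_sub_sub_inner_gradient_le hf.differentiable_avg
    (hf.norm_gradient_avg_sub_le hn)
  have hfp := (abs_le.1 (hsmooth x p)).2
  have hfz := (abs_le.1 (hsmooth x z)).1
  have hpolar : inner ℝ (x - p) (z - p) = (‖p - x‖ ^ 2 + ‖p - z‖ ^ 2 - ‖z - x‖ ^ 2) / 2 := by
    rw [real_inner_eq_norm_mul_self_add_norm_mul_self_sub_norm_sub_mul_self_div_two,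
      sub_sub_sub_cancel_right, norm_sub_rev x p, norm_sub_rev z p, norm_sub_rev x z]
    ring
  have hshift : 1 / γ * inner ℝ (x - γ • v - p) (z - p)
      = 1 / (2 * γ) * (‖p - x‖ ^ 2 + ‖p - z‖ ^ 2 - ‖z - x‖ ^ 2) - inner ℝ v (z - p) := by
    rw [sub_right_comm, inner_sub_left, real_inner_smul_left, hpolar]
    field_simp
  have hgrad : inner ℝ (gradient (avg f) x) (p - x) - inner ℝ (gradient (avg f) x) (z - x)
      = inner ℝ (gradient (avg f) x) (p - z) := by
    rw [← inner_sub_right, sub_sub_sub_cancel_right]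
  rw [gap_eq hconv hp, gap_eq hconv hz, inner_sub_left]
  rw [hshift, ← neg_sub p z, inner_neg_right] at hsub
  linarith

theorem gap_prox_le_of_isRPL (hγL : L * γ ≤ 1 / 4) (hrpl : IsRPL f h γ μ) {x : E d}
    (hx : h x ≠ ⊤) (v : E d) :
    gap f h (prox h γ (x - γ • v)) ≤ rate γ μ * gap f h x
      - 3 / (8 * γ) * ‖prox h γ (x - γ • v) - x‖ ^ 2
      + γ / 2 * ‖v - gradient (avg f) x‖ ^ 2 := by
  -- compare `p` with the exact step `y`, and `y` with `x`
  have hy := prox_ne_top hprox hγ hx (x - γ • gradient (avg f) x)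
  have hyx := gap_prox_le hconv hprox hγ hn hf (x := x) (v := gradient (avg f) x) hx
  have hpy := gap_prox_le hconv hprox hγ hn hf (x := x) (v := v) hy
  have hgrad := hrpl x (objective_ne_top_iff.2 hx)
  rw [gradMap, norm_smul, Real.norm_of_nonneg (by positivity), norm_sub_rev] at hgrad
  set y := prox h γ (x - γ • gradient (avg f) x)
  set p := prox h γ (x - γ • v)
  have hyoung := inner_le_add_norm_sq hγ (gradient (avg f) x - v) (p - y)
  rw [norm_sub_rev (gradient (avg f) x) v] at hyoung
  simp only [sub_self, inner_zero_left, norm_zero] at hyx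
  have hdecrease : γ / 2 * μ * gap f h x ≤ 1 / (4 * γ) * ‖y - x‖ ^ 2 :=
    calc γ / 2 * μ * gap f h x = γ / 4 * (2 * μ * gap f h x) := by ring
      _ ≤ γ / 4 * (1 / γ * ‖y - x‖) ^ 2 := by gcongr
      _ = 1 / (4 * γ) * ‖y - x‖ ^ 2 := by field_simp
  have hL : L ≤ 1 / 4 / γ := (le_div_iff₀ hγ).2 hγL
  have hLy : L * ‖y - x‖ ^ 2 ≤ 1 / 4 / γ * ‖y - x‖ ^ 2 := by gcongr
  have hLp : L * ‖p - x‖ ^ 2 ≤ 1 / 4 / γ * ‖p - x‖ ^ 2 := by gcongr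
  rw [rate]
  field_simp at hyx hpy hyoung hdecrease hLy hLp ⊢
  linarith

end Step

/-! ### Surrogates of the gradient -/

theorem norm_sum_sq_le_card_mul_sum_sq {ι V : Type*} [SeminormedAddCommGroup V] (s : Finset ι)
    (w : ι → V) : ‖∑ i ∈ s, w i‖ ^ 2 ≤ s.card * ∑ i ∈ s, ‖w i‖ ^ 2 :=
  (pow_le_pow_left₀ (norm_nonneg _) (norm_sum_le s w) 2).trans sq_sum_le_card_mul_sum_sq

section InnerProductSpace

variable {ι V : Type*} [NormedAddCommGroup V] [InnerProductSpace ℝ V]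

theorem norm_sq_sum_smul_of_orthonormal {v : ι → V} (hv : Orthonormal ℝ v) (s : Finset ι)
    (c : ι → ℝ) : ‖∑ j ∈ s, c j • v j‖ ^ 2 = ∑ j ∈ s, c j ^ 2 := by
  rw [← real_inner_self_eq_norm_sq, hv.inner_sum]
  simp [sq]

variable [CompleteSpace V] {f : V → ℝ} {L β : ℝ}

theorem abs_finiteDiff_sub_inner_gradient_le (hf : Differentiable ℝ f)
    (hL : ∀ x y, ‖gradient f x - gradient f y‖ ≤ L * ‖x - y‖) (hβ : β ≠ 0) {v : V} (hv : ‖v‖ = 1)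
    (x : V) : |(f (x + β • v) - f x) / β - inner ℝ (gradient f x) v| ≤ L / 2 * |β| := by
  have htaylor := abs_sub_sub_inner_gradient_le hf hL x (x + β • v)
  rw [add_sub_cancel_left, inner_smul_right, norm_smul, hv, mul_one, Real.norm_eq_abs] at htaylor
  have hquot : (f (x + β • v) - f x) / β - inner ℝ (gradient f x) v
      = (f (x + β • v) - f x - β * inner ℝ (gradient f x) v) / β := by field_simp
  rw [hquot, abs_div, div_le_iff₀ (abs_pos.2 hβ)]
  linarith

theorem norm_sq_sum_finiteDiff_sub_le (hf : Differentiable ℝ f)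
    (hL : ∀ x y, ‖gradient f x - gradient f y‖ ≤ L * ‖x - y‖) (hβ : β ≠ 0) {v : ι → V}
    (hv : Orthonormal ℝ v) (s : Finset ι) (x : V) :
    ‖∑ j ∈ s, ((f (x + β • v j) - f x) / β) • v j - ∑ j ∈ s, inner ℝ (gradient f x) (v j) • v j‖ ^ 2
      ≤ s.card * (L / 2 * β) ^ 2 := by
  simp only [← Finset.sum_sub_distrib, ← sub_smul]
  rw [norm_sq_sum_smul_of_orthonormal hv, ← nsmul_eq_mul]
  refine Finset.sum_le_card_nsmul _ _ _ fun j _ => ?_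
  rw [sq_le_sq, abs_mul]
  exact (abs_finiteDiff_sub_inner_gradient_le hf hL hβ (hv.1 j) x).trans
    (mul_le_mul_of_nonneg_right (le_abs_self _) (abs_nonneg β))

end InnerProductSpace

section Surrogate

variable {d n b : ℕ}

theorem basisVec_eq_basisFun : (basisVec : Fin d → E d) = EuclideanSpace.basisFun (Fin d) ℝ := by
  funext j
  simp [basisVec]

theorem dirVec_apply (G : OGroup d) (j a : Fin d) :
    dirVec G j a = (G : Matrix (Fin d) (Fin d) ℝ) a j := by
  simp [dirVec, basisVec]

theorem orthonormal_dirVec (G : OGroup d) : Orthonormal ℝ (dirVec G) := by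
  rw [orthonormal_iff_ite]
  intro j k
  have hcol := congrFun₂ ((Matrix.mem_orthogonalGroup_iff' (Fin d) ℝ).1 G.2) j k
  rw [Matrix.mul_apply, Matrix.one_apply] at hcol
  rw [← hcol, PiLp.inner_apply]
  refine Finset.sum_congr rfl fun a _ => ?_
  simp [dirVec_apply, mul_comm]

theorem card_filter_val_lt_eq {ℓ : ℕ} (hℓd : ℓ ≤ d) :
    (Finset.univ.filter fun j : Fin d => j.val < ℓ).card = ℓ := by
  rw [Fin.card_filter_val_lt, min_eq_right hℓd]

/-- The orthogonal projection of `w` onto the span of the first `ℓ` columns of `G`, scaled by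
`d/ℓ`. The surrogate `stochApprox` at `x` approximates the sketch of `∇f_i(x)`. -/
noncomputable def sketch (ℓ : ℕ) (G : OGroup d) (w : E d) : E d :=
  ((d : ℝ) / ℓ) • ∑ j : Fin d with j.val < ℓ, inner ℝ w (dirVec G j) • dirVec G j

theorem sketch_sub (ℓ : ℕ) (G : OGroup d) (u w : E d) :
    sketch ℓ G (u - w) = sketch ℓ G u - sketch ℓ G w := by
  simp only [sketch, inner_sub_left, sub_smul, Finset.sum_sub_distrib, smul_sub]

/-- The search direction with finite differences replaced by sketches of gradients and without
its deterministic part `fullApprox`. -/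
noncomputable def sketchDir (f : Fin n → E d → ℝ) (ℓ : ℕ) (ξ : Fin b → Fin n × OGroup d)
    (x₀ x : E d) : E d :=
  (1 / (b : ℝ)) • ∑ j, sketch ℓ (ξ j).2 (gradient (f (ξ j).1) x - gradient (f (ξ j).1) x₀)

/-- The factor of `β²` in the bound for the discretization error of the search direction. -/
noncomputable def biasConst (L : ℝ) (d ℓ : ℕ) : ℝ := 6 * L ^ 2 * (d : ℝ) ^ 2 / ℓ + L ^ 2 * d

variable {f : Fin n → E d → ℝ} {L β : ℝ} {ℓ : ℕ}

theorem norm_sq_fullApprox_sub_gradient_le (hn : 0 < n) (hf : IsSmoothFamily f L) (hβ : β ≠ 0)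
    (x : E d) : ‖fullApprox f β x - gradient (avg f) x‖ ^ 2 ≤ d * (L / 2 * β) ^ 2 := by
  have hexpand : ∑ j, inner ℝ (gradient (avg f) x) (basisVec j) • basisVec j
      = gradient (avg f) x := by
    simp_rw [real_inner_comm, basisVec_eq_basisFun]
    exact (EuclideanSpace.basisFun (Fin d) ℝ).sum_repr' _
  have horth : Orthonormal ℝ (basisVec : Fin d → E d) := by
    rw [basisVec_eq_basisFun]
    exact (EuclideanSpace.basisFun (Fin d) ℝ).orthonormal
  have hle := norm_sq_sum_finiteDiff_sub_le hf.differentiable_avg (hf.norm_gradient_avg_sub_le hn)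
    hβ horth Finset.univ x
  rwa [hexpand, Finset.card_univ, Fintype.card_fin] at hle

theorem norm_sq_stochApprox_sub_sketch_le (hℓd : ℓ ≤ d) (hf : IsSmoothFamily f L) (hβ : β ≠ 0)
    (i : Fin n) (G : OGroup d) (x : E d) :
    ‖stochApprox f ℓ β i G x - sketch ℓ G (gradient (f i) x)‖ ^ 2
      ≤ (d : ℝ) ^ 2 / ℓ * (L / 2 * β) ^ 2 := by
  have hle := norm_sq_sum_finiteDiff_sub_le (hf i).1 (hf i).2 hβ (orthonormal_dirVec G)
    (Finset.univ.filter fun j : Fin d => j.val < ℓ) x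
  rw [card_filter_val_lt_eq hℓd] at hle
  rw [stochApprox, sketch, ← smul_sub, norm_smul, mul_pow, Real.norm_eq_abs, sq_abs]
  calc _ ≤ ((d : ℝ) / ℓ) ^ 2 * (ℓ * (L / 2 * β) ^ 2) := by gcongr
    _ = (d : ℝ) ^ 2 / ℓ * (L / 2 * β) ^ 2 := by
      rcases eq_or_ne (ℓ : ℝ) 0 with hℓ | hℓ
      · simp [hℓ]
      · field_simp

theorem norm_sq_stochApprox_sub_sub_sketch_le (hℓd : ℓ ≤ d) (hf : IsSmoothFamily f L) (hβ : β ≠ 0)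
    (i : Fin n) (G : OGroup d) (x₀ x : E d) :
    ‖stochApprox f ℓ β i G x - stochApprox f ℓ β i G x₀
        - sketch ℓ G (gradient (f i) x - gradient (f i) x₀)‖ ^ 2
      ≤ (d : ℝ) ^ 2 / ℓ * (L * β) ^ 2 := by
  have hx := norm_sq_stochApprox_sub_sketch_le hℓd hf hβ i G x
  have hx₀ := norm_sq_stochApprox_sub_sketch_le hℓd hf hβ i G x₀
  rw [sketch_sub, sub_sub_sub_comm]
  set u := stochApprox f ℓ β i G x - sketch ℓ G (gradient (f i) x)
  set w := stochApprox f ℓ β i G x₀ - sketch ℓ G (gradient (f i) x₀)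
  have hparallelogram := parallelogram_law_with_norm ℝ u w
  calc ‖u - w‖ ^ 2 ≤ 2 * (‖u‖ ^ 2 + ‖w‖ ^ 2) := by nlinarith [sq_nonneg ‖u + w‖]
    _ ≤ 2 * ((d : ℝ) ^ 2 / ℓ * (L / 2 * β) ^ 2 + (d : ℝ) ^ 2 / ℓ * (L / 2 * β) ^ 2) := by gcongr
    _ = (d : ℝ) ^ 2 / ℓ * (L * β) ^ 2 := by ring

theorem norm_sq_searchDir_sub_gradient_le (hn : 0 < n) (hb : 0 < b) (hℓd : ℓ ≤ d)
    (hf : IsSmoothFamily f L) (hβ : β ≠ 0) (ξ : Fin b → Fin n × OGroup d) (x₀ x : E d) :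
    ‖searchDir f ℓ β ξ x₀ x - gradient (avg f) x‖ ^ 2
      ≤ 3 * ‖sketchDir f ℓ ξ x₀ x - (gradient (avg f) x - gradient (avg f) x₀)‖ ^ 2
        + biasConst L d ℓ * β ^ 2 := by
  let A := sketchDir f ℓ ξ x₀ x - (gradient (avg f) x - gradient (avg f) x₀)
  let B := (1 / (b : ℝ)) • ∑ j, (stochApprox f ℓ β (ξ j).1 (ξ j).2 x
    - stochApprox f ℓ β (ξ j).1 (ξ j).2 x₀
    - sketch ℓ (ξ j).2 (gradient (f (ξ j).1) x - gradient (f (ξ j).1) x₀))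
  let C := fullApprox f β x₀ - gradient (avg f) x₀
  have hsplit : searchDir f ℓ β ξ x₀ x - gradient (avg f) x = ∑ i, ![A, B, C] i := by
    simp only [Fin.sum_univ_three, Matrix.cons_val, A, B, C, searchDir, sketchDir,
      Finset.sum_sub_distrib, smul_sub]
    abel
  have hB : ‖B‖ ^ 2 ≤ (d : ℝ) ^ 2 / ℓ * (L * β) ^ 2 := by
    rw [← Real.le_sqrt (norm_nonneg _) (by positivity)]
    exact norm_inv_smul_sum_le hb fun j => Real.le_sqrt_of_sq_le
      (norm_sq_stochApprox_sub_sub_sketch_le hℓd hf hβ _ _ x₀ x)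
  have hC : ‖C‖ ^ 2 ≤ d * (L / 2 * β) ^ 2 := norm_sq_fullApprox_sub_gradient_le hn hf hβ x₀
  calc ‖searchDir f ℓ β ξ x₀ x - gradient (avg f) x‖ ^ 2
      ≤ 3 * (‖A‖ ^ 2 + ‖B‖ ^ 2 + ‖C‖ ^ 2) := by
        rw [hsplit]
        simpa [Fin.sum_univ_three] using norm_sum_sq_le_card_mul_sum_sq Finset.univ ![A, B, C]
    _ ≤ 3 * (‖A‖ ^ 2 + (d : ℝ) ^ 2 / ℓ * (L * β) ^ 2 + d * (L / 2 * β) ^ 2) := by gcongr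
    _ ≤ 3 * ‖A‖ ^ 2 + biasConst L d ℓ * β ^ 2 := by
        have hdℓ : 0 ≤ (d : ℝ) ^ 2 / ℓ * (L * β) ^ 2 := by positivity
        have hd : 0 ≤ d * (L * β) ^ 2 := by positivity
        have hbias : biasConst L d ℓ * β ^ 2
            = 6 * ((d : ℝ) ^ 2 / ℓ * (L * β) ^ 2) + d * (L * β) ^ 2 := by rw [biasConst]; ring
        rw [hbias]
        linarith

section Continuity

theorem continuous_dirVec (j : Fin d) : Continuous fun G : OGroup d => dirVec G j :=
  (PiLp.continuous_toLp 2 _).comp (continuous_subtype_val.matrix_mulVec continuous_const)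

theorem continuous_sketch_left (ℓ : ℕ) (w : E d) :
    Continuous fun G : OGroup d => sketch ℓ G w := by
  have hdir := continuous_dirVec (d := d)
  unfold sketch
  fun_prop

theorem continuous_stochApprox (hf : ∀ i, Continuous (f i)) (ℓ : ℕ) (β : ℝ) :
    Continuous fun q : Fin n × OGroup d × E d => stochApprox f ℓ β q.1 q.2.1 q.2.2 :=
  continuous_prod_of_discrete_left.2 fun i => by
    have hi := hf i
    have hdir := continuous_dirVec (d := d)
    dsimp only [stochApprox]
    fun_prop

theorem continuous_searchDir {X : Type*} [TopologicalSpace X] {ξ : X → Fin b → Fin n × OGroup d}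
    {x₀ x : X → E d} (hf : ∀ i, Continuous (f i)) (ℓ : ℕ) (β : ℝ) (hξ : Continuous ξ)
    (hx₀ : Continuous x₀) (hx : Continuous x) :
    Continuous fun a => searchDir f ℓ β (ξ a) (x₀ a) (x a) := by
  have havg : Continuous (avg f) := by unfold avg; fun_prop
  have harg : ∀ j, Continuous fun a => ((ξ a j).1, (ξ a j).2, x a) := by fun_prop
  have harg₀ : ∀ j, Continuous fun a => ((ξ a j).1, (ξ a j).2, x₀ a) := by fun_prop
  have hstoch := fun j => ((continuous_stochApprox hf ℓ β).comp (harg j)).sub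
    ((continuous_stochApprox hf ℓ β).comp (harg₀ j))
  refine ((continuous_finsetSum Finset.univ fun j _ => hstoch j).const_smul (1 / (b : ℝ))).add ?_
  unfold fullApprox
  fun_prop

theorem continuous_sketchDir_left (f : Fin n → E d → ℝ) (ℓ : ℕ) (x₀ x : E d) :
    Continuous fun ξ : Fin b → Fin n × OGroup d => sketchDir f ℓ ξ x₀ x := by
  have hsketch : Continuous fun q : Fin n × OGroup d =>
      sketch ℓ q.2 (gradient (f q.1) x - gradient (f q.1) x₀) :=
    continuous_prod_of_discrete_left.2 fun i =>
      continuous_sketch_left ℓ (gradient (f i) x - gradient (f i) x₀)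
  have hbatch : ∀ j, Continuous fun ξ : Fin b → Fin n × OGroup d =>
      sketch ℓ (ξ j).2 (gradient (f (ξ j).1) x - gradient (f (ξ j).1) x₀) := fun j =>
    hsketch.comp (continuous_apply j)
  unfold sketchDir
  fun_prop

end Continuity

end Surrogate

/-! ### The Haar measure on the orthogonal group -/

section Haar

variable {d ℓ : ℕ}

instance : CompactSpace (OGroup d) := by
  have hbox : IsCompact {A : Fin d → Fin d → ℝ | ∀ a k, A a k ∈ Set.Icc (-1 : ℝ) 1} := by
    simpa only [Set.pi, Set.mem_univ, true_imp_iff, Set.mem_ofPred_eq] using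
      isCompact_univ_pi fun _ : Fin d => isCompact_univ_pi fun _ : Fin d =>
        isCompact_Icc (a := (-1 : ℝ)) (b := 1)
  have hclosed : IsClosed (Matrix.orthogonalGroup (Fin d) ℝ : Set (Matrix (Fin d) (Fin d) ℝ)) :=
    isClosed_unitary
  exact isCompact_iff_compactSpace.1 <| IsCompact.of_isClosed_subset
    (X := Matrix (Fin d) (Fin d) ℝ) hbox hclosed fun G hG a k =>
      abs_le.1 (entry_norm_bound_of_unitary hG a k)

instance : SecondCountableTopology (OGroup d) :=
  have : SecondCountableTopology (Matrix (Fin d) (Fin d) ℝ) :=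
    inferInstanceAs (SecondCountableTopology (Fin d → Fin d → ℝ))
  Topology.IsEmbedding.subtypeVal.secondCountableTopology

theorem integrable_of_continuous_of_compactSpace {X V : Type*} [TopologicalSpace X]
    [CompactSpace X] [MeasurableSpace X] [OpensMeasurableSpace X] [NormedAddCommGroup V]
    [SecondCountableTopologyEither X V] {Q : Measure X} [IsFiniteMeasure Q] {φ : X → V}
    (hφ : Continuous φ) : Integrable φ Q :=
  hφ.integrable_of_hasCompactSupport (HasCompactSupport.of_compactSpace φ)

/-- The orthogonal matrix that changes the sign of the coordinate `a`. -/
noncomputable def signFlip (a : Fin d) : OGroup d :=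
  ⟨Matrix.diagonal fun i => if i = a then -1 else 1, by
    rw [Matrix.mem_orthogonalGroup_iff, Matrix.diagonal_transpose,
      Matrix.diagonal_mul_diagonal, ← Matrix.diagonal_one]
    congr 1
    funext i
    split_ifs <;> norm_num⟩

theorem signFlip_mul_apply (a i k : Fin d) (G : OGroup d) :
    ((signFlip a * G : OGroup d) : Matrix (Fin d) (Fin d) ℝ) i k
      = (if i = a then -1 else 1) * (G : Matrix (Fin d) (Fin d) ℝ) i k :=
  Matrix.diagonal_mul _ _ _ _

/-- The permutation matrix of `σ` as an orthogonal matrix. -/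
noncomputable def permOrthogonal (σ : Equiv.Perm (Fin d)) : OGroup d :=
  ⟨σ.permMatrix ℝ, by
    rw [Matrix.mem_orthogonalGroup_iff, Matrix.transpose_permMatrix, ← Matrix.permMatrix_mul]
    simp⟩

theorem permOrthogonal_mul_apply (σ : Equiv.Perm (Fin d)) (i k : Fin d) (G : OGroup d) :
    ((permOrthogonal σ * G : OGroup d) : Matrix (Fin d) (Fin d) ℝ) i k
      = (G : Matrix (Fin d) (Fin d) ℝ) (σ i) k :=
  congrFun₂ (PEquiv.toMatrix_toPEquiv_mul σ (G : Matrix (Fin d) (Fin d) ℝ)) i k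

variable (Q : Measure (OGroup d)) [Q.IsMulLeftInvariant]

theorem integral_orthogonal_mul_of_ne {a a' : Fin d} (haa' : a ≠ a') (k k' : Fin d) :
    ∫ G : OGroup d, (G : Matrix (Fin d) (Fin d) ℝ) a k * (G : Matrix (Fin d) (Fin d) ℝ) a' k' ∂Q
      = 0 := by
  have hflip := integral_mul_left_eq_self (μ := Q) (fun G : OGroup d =>
    (G : Matrix (Fin d) (Fin d) ℝ) a k * (G : Matrix (Fin d) (Fin d) ℝ) a' k') (signFlip a)
  simp only [signFlip_mul_apply, if_true, if_neg haa'.symm, one_mul, neg_mul, integral_neg] at hflip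
  exact self_eq_neg.1 hflip.symm

variable [IsProbabilityMeasure Q]

theorem integral_orthogonal_sq (a k : Fin d) :
    ∫ G : OGroup d, (G : Matrix (Fin d) (Fin d) ℝ) a k ^ 2 ∂Q = 1 / d := by
  have hswap : ∀ i, ∫ G : OGroup d, (G : Matrix (Fin d) (Fin d) ℝ) i k ^ 2 ∂Q
      = ∫ G : OGroup d, (G : Matrix (Fin d) (Fin d) ℝ) a k ^ 2 ∂Q := fun i => by
    rw [← integral_mul_left_eq_self _ (permOrthogonal (Equiv.swap a i))]
    simp [permOrthogonal_mul_apply]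
  have hcol : ∀ G : OGroup d, ∑ i, (G : Matrix (Fin d) (Fin d) ℝ) i k ^ 2 = 1 := fun G => by
    have hunit := (orthonormal_dirVec G).1 k
    rw [EuclideanSpace.norm_eq, Real.sqrt_eq_one] at hunit
    simpa [dirVec_apply] using hunit
  have hint : ∀ i, Integrable (fun G : OGroup d => (G : Matrix (Fin d) (Fin d) ℝ) i k ^ 2) Q :=
    fun i => integrable_of_continuous_of_compactSpace
      ((continuous_subtype_val.matrix_elem i k).pow 2)
  have hsum : ∑ i, ∫ G : OGroup d, (G : Matrix (Fin d) (Fin d) ℝ) i k ^ 2 ∂Q = 1 := by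
    rw [← integral_finsetSum _ fun i _ => hint i]
    simp [hcol]
  have hd : (d : ℝ) ≠ 0 := Nat.cast_ne_zero.2 a.pos.ne'
  rw [Finset.sum_congr rfl fun i _ => hswap i, Finset.sum_const, Finset.card_univ,
    Fintype.card_fin, nsmul_eq_mul] at hsum
  rw [eq_div_iff hd, mul_comm, hsum]

theorem integral_inner_dirVec_mul_inner_dirVec (u w : E d) (j : Fin d) :
    ∫ G : OGroup d, inner ℝ u (dirVec G j) * inner ℝ w (dirVec G j) ∂Q = inner ℝ u w / d := by
  have hexpand : ∀ G : OGroup d, inner ℝ u (dirVec G j) * inner ℝ w (dirVec G j)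
      = ∑ a, ∑ a', u a * w a' * ((G : Matrix (Fin d) (Fin d) ℝ) a j
        * (G : Matrix (Fin d) (Fin d) ℝ) a' j) := fun G => by
    simp only [PiLp.inner_apply, dirVec_apply, RCLike.inner_apply, conj_trivial,
      Finset.sum_mul_sum]
    exact Finset.sum_congr rfl fun a _ => Finset.sum_congr rfl fun a' _ => by ring
  have hint : ∀ a a', Integrable (fun G : OGroup d => u a * w a' *
      ((G : Matrix (Fin d) (Fin d) ℝ) a j * (G : Matrix (Fin d) (Fin d) ℝ) a' j)) Q :=
    fun a a' => integrable_of_continuous_of_compactSpace <| continuous_const.mul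
      ((continuous_subtype_val.matrix_elem a j).mul (continuous_subtype_val.matrix_elem a' j))
  have hmoment : ∀ a a', ∫ G : OGroup d, (G : Matrix (Fin d) (Fin d) ℝ) a j
      * (G : Matrix (Fin d) (Fin d) ℝ) a' j ∂Q = if a = a' then 1 / (d : ℝ) else 0 := by
    intro a a'
    split_ifs with haa'
    · simp only [← haa', ← sq, integral_orthogonal_sq]
    · exact integral_orthogonal_mul_of_ne Q haa' j j
  simp only [hexpand]
  rw [integral_finsetSum _ fun a _ => integrable_finsetSum _ fun a' _ => hint a a']
  simp only [integral_finsetSum _ fun a' _ => hint _ a', integral_const_mul, hmoment, mul_ite,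
    mul_zero, Finset.sum_ite_eq, Finset.mem_univ, if_true, Finset.sum_div, PiLp.inner_apply,
    RCLike.inner_apply, conj_trivial, mul_one_div]
  simp only [mul_comm]

variable (hℓ : 0 < ℓ) (hℓd : ℓ ≤ d)

theorem inner_sketch (ℓ : ℕ) (G : OGroup d) (u w : E d) :
    inner ℝ u (sketch ℓ G w)
      = (d : ℝ) / ℓ * ∑ j : Fin d with j.val < ℓ,
        inner ℝ u (dirVec G j) * inner ℝ w (dirVec G j) := by
  simp only [sketch, inner_smul_right, inner_sum, mul_comm]

theorem norm_sq_sketch (ℓ : ℕ) (G : OGroup d) (w : E d) :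
    ‖sketch ℓ G w‖ ^ 2 = (d : ℝ) / ℓ * inner ℝ w (sketch ℓ G w) := by
  rw [inner_sketch, sketch, norm_smul, mul_pow, norm_sq_sum_smul_of_orthonormal
    (orthonormal_dirVec G), Real.norm_eq_abs, sq_abs, sq, mul_assoc]
  simp only [sq]

include hℓ hℓd

theorem integral_inner_sketch (u w : E d) :
    ∫ G : OGroup d, inner ℝ u (sketch ℓ G w) ∂Q = inner ℝ u w := by
  have hℓ' : (ℓ : ℝ) ≠ 0 := Nat.cast_ne_zero.2 hℓ.ne'
  have hd' : (d : ℝ) ≠ 0 := Nat.cast_ne_zero.2 (hℓ.trans_le hℓd).ne'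
  have hdir := continuous_dirVec (d := d)
  simp only [inner_sketch]
  rw [integral_const_mul, integral_finsetSum _ fun j _ =>
    integrable_of_continuous_of_compactSpace (by fun_prop)]
  simp only [integral_inner_dirVec_mul_inner_dirVec, Finset.sum_const, card_filter_val_lt_eq hℓd,
    nsmul_eq_mul]
  field_simp

theorem integral_sketch (w : E d) : ∫ G : OGroup d, sketch ℓ G w ∂Q = w := by
  refine ext_inner_left ℝ fun u => ?_
  rw [← integral_inner (integrable_of_continuous_of_compactSpace (continuous_sketch_left ℓ w)),
    integral_inner_sketch Q hℓ hℓd]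

theorem integral_norm_sq_sketch (w : E d) :
    ∫ G : OGroup d, ‖sketch ℓ G w‖ ^ 2 ∂Q = (d : ℝ) / ℓ * ‖w‖ ^ 2 := by
  simp only [norm_sq_sketch]
  rw [integral_const_mul, integral_inner_sketch Q hℓ hℓd, real_inner_self_eq_norm_sq]

end Haar

/-! ### Independence -/

section Independence

variable {Ω A B V : Type*} [MeasurableSpace Ω] [MeasurableSpace A] [MeasurableSpace B]
  [NormedAddCommGroup V] {P : Measure Ω}

theorem integrable_prod_map_of_indepFun [IsProbabilityMeasure P] {X : Ω → A} {Z : Ω → B}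
    (hX : Measurable X) (hZ : Measurable Z) (hXZ : IndepFun X Z P) {φ : A × B → V}
    (hφ : StronglyMeasurable φ) (hint : Integrable (fun ω => φ (X ω, Z ω)) P) :
    Integrable φ ((P.map X).prod (P.map Z)) := by
  rw [← hXZ.map_prod_eq_prod_map_map hX.aemeasurable hZ.aemeasurable]
  exact (integrable_map_measure hφ.aestronglyMeasurable (hX.prodMk hZ).aemeasurable).2 hint

theorem integral_prodMk_of_indepFun [NormedSpace ℝ V] [IsProbabilityMeasure P] {X : Ω → A}
    {Z : Ω → B} (hX : Measurable X) (hZ : Measurable Z) (hXZ : IndepFun X Z P) {φ : A × B → V}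
    (hφ : StronglyMeasurable φ) (hint : Integrable (fun ω => φ (X ω, Z ω)) P) :
    ∫ ω, φ (X ω, Z ω) ∂P = ∫ a, ∫ ω, φ (a, Z ω) ∂P ∂(P.map X) := by
  have := Measure.isProbabilityMeasure_map (μ := P) hX.aemeasurable
  have := Measure.isProbabilityMeasure_map (μ := P) hZ.aemeasurable
  rw [← integral_map (hX.prodMk hZ).aemeasurable hφ.aestronglyMeasurable,
    hXZ.map_prod_eq_prod_map_map hX.aemeasurable hZ.aemeasurable,
    integral_prod φ (integrable_prod_map_of_indepFun hX hZ hXZ hφ hint)]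
  refine integral_congr_ae (ae_of_all _ fun a => ?_)
  exact integral_map hZ.aemeasurable
    (hφ.comp_measurable measurable_prodMk_left).aestronglyMeasurable

-- the conditional expectation given `X` is computed by freezing `X`
theorem integral_prodMk_le_of_indepFun [IsProbabilityMeasure P] {X : Ω → A} {Z : Ω → B}
    (hX : Measurable X) (hZ : Measurable Z) (hXZ : IndepFun X Z P) {φ : A × B → ℝ}
    (hφ : StronglyMeasurable φ) (hint : Integrable (fun ω => φ (X ω, Z ω)) P) {ψ : A → ℝ}
    (hψ : StronglyMeasurable ψ) (hψint : Integrable (fun ω => ψ (X ω)) P)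
    (hle : ∀ a, ∫ ω, φ (a, Z ω) ∂P ≤ ψ a) :
    ∫ ω, φ (X ω, Z ω) ∂P ≤ ∫ ω, ψ (X ω) ∂P := by
  have := Measure.isProbabilityMeasure_map (μ := P) hX.aemeasurable
  have := Measure.isProbabilityMeasure_map (μ := P) hZ.aemeasurable
  have hsection : ∀ a, ∫ z, φ (a, z) ∂(P.map Z) = ∫ ω, φ (a, Z ω) ∂P := fun a =>
    integral_map hZ.aemeasurable (hφ.comp_measurable measurable_prodMk_left).aestronglyMeasurable
  have hinner := (integrable_prod_map_of_indepFun hX hZ hXZ hφ hint).integral_prod_left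
  simp only [hsection] at hinner
  rw [integral_prodMk_of_indepFun hX hZ hXZ hφ hint,
    ← integral_map hX.aemeasurable hψ.aestronglyMeasurable]
  exact integral_mono hinner
    ((integrable_map_measure hψ.aestronglyMeasurable hX.aemeasurable).2 hψint) hle

end Independence

section Variance

variable {Ω V : Type*} [MeasurableSpace Ω] {P : Measure Ω} [NormedAddCommGroup V]
  [InnerProductSpace ℝ V] [CompleteSpace V]

theorem integral_norm_sq_sub_integral_le [IsProbabilityMeasure P] {Y : Ω → V} (hY : MemLp Y 2 P) :
    ∫ ω, ‖Y ω - ∫ ω', Y ω' ∂P‖ ^ 2 ∂P ≤ ∫ ω, ‖Y ω‖ ^ 2 ∂P := by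
  have hY₁ := hY.integrable one_le_two
  set M := ∫ ω, Y ω ∂P with hM
  have hexpand : ∀ ω, ‖Y ω - M‖ ^ 2 = ‖Y ω‖ ^ 2 - 2 * inner ℝ M (Y ω) + ‖M‖ ^ 2 := fun ω => by
    rw [norm_sub_sq_real, real_inner_comm]
  have hsq : Integrable (fun ω => ‖Y ω‖ ^ 2) P := hY.integrable_norm_pow two_ne_zero
  have hcross : Integrable (fun ω => 2 * inner ℝ M (Y ω)) P := (hY₁.const_inner M).const_mul 2
  have hdiff : Integrable (fun ω => ‖Y ω‖ ^ 2 - 2 * inner ℝ M (Y ω)) P := hsq.sub hcross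
  simp only [hexpand]
  rw [integral_add hdiff (integrable_const _), integral_sub hsq hcross,
    integral_const_mul, integral_inner hY₁, ← hM, real_inner_self_eq_norm_sq]
  simp only [integral_const, probReal_univ, one_smul]
  linarith [sq_nonneg ‖M‖]

variable [MeasurableSpace V] [BorelSpace V]

theorem integral_norm_sq_sum_eq_of_pairwise_indepFun [IsFiniteMeasure P] {ι : Type*} [Fintype ι]
    {Y : ι → Ω → V} (hY : ∀ j, MemLp (Y j) 2 P)
    (hindep : Pairwise fun j j' => IndepFun (Y j) (Y j') P) (hmean : ∀ j, ∫ ω, Y j ω ∂P = 0) :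
    ∫ ω, ‖∑ j, Y j ω‖ ^ 2 ∂P = ∑ j, ∫ ω, ‖Y j ω‖ ^ 2 ∂P := by
  classical
  have hY₁ := fun j => (hY j).integrable one_le_two
  have hint : ∀ j j', Integrable (fun ω => inner ℝ (Y j ω) (Y j' ω)) P := fun j j' =>
    ((hY j).norm.integrable_mul (hY j').norm).mono'
      ((hY j).aestronglyMeasurable.inner (hY j').aestronglyMeasurable)
      (ae_of_all _ fun ω => norm_inner_le_norm _ _)
  have hcross : ∀ j j', ∫ ω, inner ℝ (Y j ω) (Y j' ω) ∂P
      = if j = j' then ∫ ω, ‖Y j ω‖ ^ 2 ∂P else 0 := fun j j' => by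
    split_ifs with hjj'
    · simp only [← hjj', real_inner_self_eq_norm_sq]
    · refine ((hindep hjj').integral_bilin (hY₁ j) (hY₁ j') (innerSL ℝ)).trans ?_
      rw [hmean, map_zero, zero_apply]
  simp only [← real_inner_self_eq_norm_sq, sum_inner, inner_sum]
  rw [integral_finsetSum _ fun j _ => integrable_finsetSum _ fun j' _ => hint j' j]
  simp only [integral_finsetSum _ fun _ _ => hint _ _, hcross, Finset.mem_univ, if_true,
    Finset.sum_ite_eq', real_inner_self_eq_norm_sq]

theorem integral_norm_sq_average_sub_le [IsProbabilityMeasure P] {b : ℕ} {Y : Fin b → Ω → V}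
    {M : V} {K : ℝ} (hb : 0 < b) (hY : ∀ j, MemLp (Y j) 2 P)
    (hindep : Pairwise fun j j' => IndepFun (Y j) (Y j') P) (hmean : ∀ j, ∫ ω, Y j ω ∂P = M)
    (hK : ∀ j, ∫ ω, ‖Y j ω‖ ^ 2 ∂P ≤ K) :
    ∫ ω, ‖(1 / (b : ℝ)) • ∑ j, Y j ω - M‖ ^ 2 ∂P ≤ 1 / b * K := by
  have hb' : (b : ℝ) ≠ 0 := Nat.cast_ne_zero.2 hb.ne'
  have hcenter : ∀ ω, ‖(1 / (b : ℝ)) • ∑ j, Y j ω - M‖ ^ 2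
      = (1 / (b : ℝ)) ^ 2 * ‖∑ j, (Y j ω - M)‖ ^ 2 := fun ω => by
    rw [← sq_abs (1 / (b : ℝ)), ← Real.norm_eq_abs, ← mul_pow, ← norm_smul,
      Finset.sum_sub_distrib, smul_sub, Finset.sum_const, Finset.card_univ, Fintype.card_fin,
      ← Nat.cast_smul_eq_nsmul ℝ, smul_smul, one_div_mul_cancel hb', one_smul]
  have hcentered : ∀ j, ∫ ω, (Y j ω - M) ∂P = 0 := fun j => by
    rw [integral_sub ((hY j).integrable one_le_two) (integrable_const M), hmean]
    simp
  have hindep' : Pairwise fun j j' => IndepFun (fun ω => Y j ω - M) (fun ω => Y j' ω - M) P :=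
    fun j j' hjj' => (hindep hjj').comp (measurable_id.sub_const M) (measurable_id.sub_const M)
  simp only [hcenter]
  rw [integral_const_mul, integral_norm_sq_sum_eq_of_pairwise_indepFun
    (Y := fun j ω => Y j ω - M) (fun j => (hY j).sub (memLp_const M)) hindep' hcentered]
  calc _ ≤ (1 / (b : ℝ)) ^ 2 * ∑ _j : Fin b, K := by
        gcongr with j
        exact (hmean j ▸ integral_norm_sq_sub_integral_le (hY j)).trans (hK j)
    _ = 1 / b * K := by
        rw [Finset.sum_const, Finset.card_univ, Fintype.card_fin, nsmul_eq_mul]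
        field_simp

end Variance

/-! ### Batches of sketches -/

section Batch

variable {d n b ℓ : ℕ} {Ω : Type*} [MeasurableSpace Ω]

/-- One draw of the algorithm: an index uniform on `{1, …, n}` and an independent matrix uniform on
`O(d)`. -/
structure IsDraw (P : Measure Ω) (I : Ω → Fin n) (G : Ω → OGroup d) : Prop where
  measurable_index : Measurable I
  measurable_matrix : Measurable G
  uniform_index : ∀ i, P {ω | I ω = i} = (n : ENNReal)⁻¹
  haar_matrix : (P.map G).IsHaarMeasure
  indep : IndepFun I G P

variable {P : Measure Ω} [IsProbabilityMeasure P]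

namespace IsDraw

variable {I : Ω → Fin n} {G : Ω → OGroup d}

theorem integral_comp {V : Type*} [NormedAddCommGroup V] [NormedSpace ℝ V]
    [CompleteSpace V] [SecondCountableTopology V]
    (hD : IsDraw P I G) {φ : Fin n → OGroup d → V} (hφ : ∀ i, Continuous (φ i)) :
    ∫ ω, φ (I ω) (G ω) ∂P = (1 / (n : ℝ)) • ∑ i, ∫ g, φ i g ∂(P.map G) := by
  borelize V
  have := Measure.isProbabilityMeasure_map (μ := P) hD.measurable_index.aemeasurable
  have hφ' : Continuous fun q : Fin n × OGroup d => φ q.1 q.2 :=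
    continuous_prod_of_discrete_left.2 hφ
  have hpair := hD.measurable_index.prodMk hD.measurable_matrix
  have := Measure.isProbabilityMeasure_map (μ := P) hpair.aemeasurable
  have hint : Integrable (fun ω => φ (I ω) (G ω)) P :=
    (integrable_of_continuous_of_compactSpace hφ').comp_measurable hpair
  have hweight : ∀ i, (P.map I).real {i} = 1 / n := fun i => by
    rw [map_measureReal_apply hD.measurable_index (measurableSet_singleton i), measureReal_def]
    exact (congrArg ENNReal.toReal (hD.uniform_index i)).trans (by simp)
  rw [integral_prodMk_of_indepFun (φ := fun q => φ q.1 q.2) hD.measurable_index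
    hD.measurable_matrix hD.indep hφ'.stronglyMeasurable hint, integral_fintype .of_finite,
    Finset.smul_sum]
  refine Finset.sum_congr rfl fun i _ => ?_
  rw [hweight, integral_map hD.measurable_matrix.aemeasurable
    (hφ i).measurable.aestronglyMeasurable]

variable (hℓ : 0 < ℓ) (hℓd : ℓ ≤ d) (hD : IsDraw P I G) (w : Fin n → E d)

include hD hℓ hℓd

theorem integral_sketch : ∫ ω, sketch ℓ (G ω) (w (I ω)) ∂P = (1 / (n : ℝ)) • ∑ i, w i := by
  have := hD.haar_matrix
  have := Measure.isProbabilityMeasure_map (μ := P) hD.measurable_matrix.aemeasurable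
  rw [hD.integral_comp (φ := fun i g => sketch ℓ g (w i)) fun i => continuous_sketch_left ℓ (w i)]
  simp only [VRSZD.integral_sketch _ hℓ hℓd]

theorem integral_norm_sq_sketch :
    ∫ ω, ‖sketch ℓ (G ω) (w (I ω))‖ ^ 2 ∂P = (1 / (n : ℝ)) * ∑ i, (d : ℝ) / ℓ * ‖w i‖ ^ 2 := by
  have := hD.haar_matrix
  have := Measure.isProbabilityMeasure_map (μ := P) hD.measurable_matrix.aemeasurable
  rw [hD.integral_comp (φ := fun i g => ‖sketch ℓ g (w i)‖ ^ 2) fun i =>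
    (continuous_sketch_left ℓ (w i)).norm.pow 2]
  simp only [VRSZD.integral_norm_sq_sketch _ hℓ hℓd, smul_eq_mul]

end IsDraw

variable {I : Fin b → Ω → Fin n} {G : Fin b → Ω → OGroup d} {f : Fin n → E d → ℝ} {L : ℝ}

theorem integral_norm_sq_sketch_average_sub_le (hn : 0 < n) (hb : 0 < b) (hℓ : 0 < ℓ) (hℓd : ℓ ≤ d)
    (hD : ∀ j, IsDraw P (I j) (G j)) (hindep : iIndepFun (fun j ω => (I j ω, G j ω)) P)
    {w : Fin n → E d} {c : ℝ} (hw : ∀ i, ‖w i‖ ≤ c) :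
    ∫ ω, ‖(1 / (b : ℝ)) • ∑ j, sketch ℓ (G j ω) (w (I j ω)) - (1 / (n : ℝ)) • ∑ i, w i‖ ^ 2 ∂P
      ≤ 1 / b * ((d : ℝ) / ℓ * c ^ 2) := by
  have hcont : Continuous fun q : Fin n × OGroup d => sketch ℓ q.2 (w q.1) :=
    continuous_prod_of_discrete_left.2 fun i => continuous_sketch_left ℓ (w i)
  obtain ⟨K, hK⟩ := (isCompact_range hcont).isBounded.exists_norm_le
  have hpair : ∀ j, Measurable fun ω => (I j ω, G j ω) := fun j =>
    (hD j).measurable_index.prodMk (hD j).measurable_matrix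
  refine integral_norm_sq_average_sub_le (Y := fun j ω => sketch ℓ (G j ω) (w (I j ω))) hb
    (fun j => MemLp.of_bound (hcont.measurable.comp (hpair j)).aestronglyMeasurable K
      (ae_of_all _ fun ω => hK _ ⟨(I j ω, G j ω), rfl⟩))
    (fun j j' hjj' => (hindep.indepFun hjj').comp hcont.measurable hcont.measurable)
    (fun j => (hD j).integral_sketch hℓ hℓd w) fun j => ?_
  have : (0 : ℝ) < n := Nat.cast_pos.2 hn
  calc _ = (1 / (n : ℝ)) * ∑ i, (d : ℝ) / ℓ * ‖w i‖ ^ 2 := (hD j).integral_norm_sq_sketch hℓ hℓd w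
    _ ≤ (1 / (n : ℝ)) * ∑ _i : Fin n, (d : ℝ) / ℓ * c ^ 2 := by gcongr with i; exact hw i
    _ = (d : ℝ) / ℓ * c ^ 2 := by
      rw [Finset.sum_const, Finset.card_univ, Fintype.card_fin, nsmul_eq_mul]
      field_simp

theorem integral_norm_sq_sketchDir_sub_le (hn : 0 < n) (hb : 0 < b) (hℓ : 0 < ℓ) (hℓd : ℓ ≤ d)
    (hf : IsSmoothFamily f L) (hD : ∀ j, IsDraw P (I j) (G j))
    (hindep : iIndepFun (fun j ω => (I j ω, G j ω)) P) (x₀ x : E d) :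
    ∫ ω, ‖sketchDir f ℓ (fun j => (I j ω, G j ω)) x₀ x
        - (gradient (avg f) x - gradient (avg f) x₀)‖ ^ 2 ∂P
      ≤ 1 / b * ((d : ℝ) / ℓ * (L * ‖x - x₀‖) ^ 2) := by
  rw [hf.gradient_avg, hf.gradient_avg, ← smul_sub, ← Finset.sum_sub_distrib]
  exact integral_norm_sq_sketch_average_sub_le hn hb hℓ hℓd hD hindep
    (w := fun i => gradient (f i) x - gradient (f i) x₀) fun i => (hf i).2 x x₀

end Batch

/-! ### The iterates as functions of the draws -/

section Iterate

variable {d n b : ℕ} {f : Fin n → E d → ℝ} {h : E d → EReal} {γ : ℝ} {ℓ m : ℕ} {β : ℕ → ℝ}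
  {x₀ : E d}

/-- The map `x_k ↦ x_{k+1}` of an inner step with outer iterate `x₀` and batch `ξ`. -/
noncomputable def innerStep (f : Fin n → E d → ℝ) (h : E d → EReal) (γ : ℝ) (ℓ : ℕ) (β : ℝ)
    (ξ : Fin b → Fin n × OGroup d) (x₀ x : E d) : E d :=
  prox h γ (x - γ • searchDir f ℓ β ξ x₀ x)

/-- The iterate `x_k^τ` of the algorithm as a function of the draws `ξ`. -/
noncomputable def iterate (f : Fin n → E d → ℝ) (h : E d → EReal) (γ : ℝ) (ℓ m : ℕ) (β : ℕ → ℝ)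
    (x₀ : E d) (τ k : ℕ) (ξ : ℕ → ℕ → Fin b → Fin n × OGroup d) : E d :=
  innerIter f h γ ℓ (β τ) (ξ τ) (outerIter f h γ ℓ m β ξ x₀ τ) k

theorem nested_loop_induction {p : ℕ → ℕ → Prop} (m : ℕ) (start : p 0 0)
    (inner : ∀ τ k, p τ 0 → p τ k → p τ (k + 1)) (outer : ∀ τ, p τ m → p (τ + 1) 0) (τ k : ℕ) :
    p τ k := by
  have hloop : ∀ τ, p τ 0 → ∀ k, p τ k := fun τ h0 k => by
    induction k with
    | zero => exact h0
    | succ k ih => exact inner τ k h0 ih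
  refine hloop τ ?_ k
  induction τ with
  | zero => exact start
  | succ τ ih => exact outer τ (hloop τ ih m)

theorem iterate_ne_top (hprox : IsProximable h) (hγ : 0 < γ) (hx₀ : h x₀ ≠ ⊤) (τ k : ℕ)
    (ξ : ℕ → ℕ → Fin b → Fin n × OGroup d) : h (iterate f h γ ℓ m β x₀ τ k ξ) ≠ ⊤ :=
  nested_loop_induction (p := fun τ k => h (iterate f h γ ℓ m β x₀ τ k ξ) ≠ ⊤) m hx₀
    (fun _ _ _ _ => prox_ne_top hprox hγ hx₀ _) (fun _ hτ => hτ) τ k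

section Continuity

variable {X : Type*} [TopologicalSpace X] {ξ : X → Fin b → Fin n × OGroup d} {x₀ x : X → E d}
  (hf : ∀ i, Continuous (f i)) (hξ : Continuous ξ) (hx₀ : Continuous x₀) (hx : Continuous x)
include hf hξ hx₀ hx

theorem continuous_sub_smul_searchDir (γ : ℝ) (ℓ : ℕ) (β : ℝ) :
    Continuous fun a => x a - γ • searchDir f ℓ β (ξ a) (x₀ a) (x a) :=
  hx.sub ((continuous_searchDir hf ℓ β hξ hx₀ hx).const_smul γ)

theorem continuous_innerStep (hp : Continuous (prox h γ)) (ℓ : ℕ) (β : ℝ) :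
    Continuous fun a => innerStep f h γ ℓ β (ξ a) (x₀ a) (x a) :=
  hp.comp (continuous_sub_smul_searchDir hf hξ hx₀ hx γ ℓ β)

end Continuity

variable (hf : ∀ i, Continuous (f i)) (hp : Continuous (prox h γ))
include hf hp

theorem measurable_innerStep {X : Type*} [MeasurableSpace X]
    {ξ : X → Fin b → Fin n × OGroup d} {x₀ x : X → E d} (hξ : Measurable ξ) (hx₀ : Measurable x₀)
    (hx : Measurable x) (ℓ : ℕ) (β : ℝ) :
    Measurable fun a => innerStep f h γ ℓ β (ξ a) (x₀ a) (x a) := by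
  have hstep : Measurable fun q : (Fin b → Fin n × OGroup d) × E d × E d =>
      innerStep f h γ ℓ β q.1 q.2.1 q.2.2 :=
    (continuous_innerStep hf continuous_fst continuous_snd.fst continuous_snd.snd hp
      ℓ β).measurable
  have harg : Measurable fun a => (ξ a, x₀ a, x a) := hξ.prodMk (hx₀.prodMk hx)
  have hcomp := hstep.comp harg
  exact hcomp

theorem continuous_iterate (τ k : ℕ) :
    Continuous fun ξ : ℕ → ℕ → Fin b → Fin n × OGroup d => iterate f h γ ℓ m β x₀ τ k ξ :=
  nested_loop_induction (p := fun τ k => Continuous fun ξ : ℕ → ℕ → Fin b → Fin n × OGroup d =>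
      iterate f h γ ℓ m β x₀ τ k ξ) m continuous_const
    (fun τ k h0 hk => continuous_innerStep hf (continuous_apply_apply τ k) h0 hk hp ℓ (β τ))
    (fun _ hτ => hτ) τ k

theorem continuous_gap_iterate (hgap : Continuous fun x => gap f h (prox h γ x)) (τ k : ℕ) :
    Continuous fun ξ : ℕ → ℕ → Fin b → Fin n × OGroup d =>
      gap f h (iterate f h γ ℓ m β x₀ τ k ξ) :=
  nested_loop_induction (p := fun τ k => Continuous fun ξ : ℕ → ℕ → Fin b → Fin n × OGroup d =>
      gap f h (iterate f h γ ℓ m β x₀ τ k ξ)) m (continuous_const (y := gap f h x₀))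
    (fun τ k _ _ => hgap.comp (continuous_sub_smul_searchDir hf (continuous_apply_apply τ k)
      (continuous_iterate hf hp τ 0) (continuous_iterate hf hp τ k) γ ℓ (β τ)))
    (fun _ hτ => hτ) τ k

theorem measurable_iterate {Ω : Type*} [MeasurableSpace Ω]
    {ξ : Ω → ℕ → ℕ → Fin b → Fin n × OGroup d} (τ k : ℕ)
    (hξ : ∀ τ' k', τ' < τ ∨ τ' = τ ∧ k' < k → Measurable fun ω => ξ ω τ' k') :
    Measurable fun ω => iterate f h γ ℓ m β x₀ τ k (ξ ω) := by
  refine nested_loop_induction (p := fun τ k => (∀ τ' k', τ' < τ ∨ τ' = τ ∧ k' < k →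
    Measurable fun ω => ξ ω τ' k') → Measurable fun ω => iterate f h γ ℓ m β x₀ τ k (ξ ω)) m
    (fun _ => measurable_const) (fun τ k h0 hk hξ => ?_) (fun τ hτ hξ => ?_) τ k hξ
  · have hx₀ : Measurable fun ω => iterate f h γ ℓ m β x₀ τ 0 (ξ ω) :=
      h0 fun τ' k' hlt => hξ τ' k' (by omega)
    have hx : Measurable fun ω => iterate f h γ ℓ m β x₀ τ k (ξ ω) :=
      hk fun τ' k' hlt => hξ τ' k' (by omega)
    have hξτk : Measurable fun ω => ξ ω τ k := hξ τ k (Or.inr ⟨rfl, k.lt_succ_self⟩)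
    exact measurable_innerStep hf hp hξτk hx₀ hx ℓ (β τ)
  · exact hτ fun τ' k' hlt => hξ τ' k' (by omega)

end Iterate

namespace IsSampling

variable {d n b : ℕ} {Ω : Type*} [MeasurableSpace Ω] {P : Measure Ω}
  {I : ℕ → ℕ → Fin b → Ω → Fin n} {G : ℕ → ℕ → Fin b → Ω → OGroup d} (hS : IsSampling P I G)
include hS

theorem measurable_draw (τ k : ℕ) (j : Fin b) : Measurable fun ω => draws I G ω τ k j :=
  (hS.measurable_index τ k j).prodMk (hS.measurable_matrix τ k j)

theorem measurable_draws : Measurable (draws I G) :=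
  measurable_pi_lambda _ fun τ => measurable_pi_lambda _ fun k =>
    measurable_pi_lambda _ fun j => hS.measurable_draw τ k j

theorem isDraw (τ k : ℕ) (j : Fin b) : IsDraw P (I τ k j) (G τ k j) :=
  ⟨hS.measurable_index τ k j, hS.measurable_matrix τ k j, hS.uniform_index τ k j,
    hS.haar_matrix τ k j, hS.indep_index_matrix τ k j⟩

theorem iIndepFun_batch (τ k : ℕ) : iIndepFun (fun j ω => (I τ k j ω, G τ k j ω)) P :=
  hS.indep_draws.precomp (g := fun j : Fin b => (τ, k, j)) fun i j hij => by simpa using hij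

theorem integrable_comp_draws [IsFiniteMeasure P]
    {φ : (ℕ → ℕ → Fin b → Fin n × OGroup d) → ℝ} (hφ : Continuous φ) :
    Integrable (fun ω => φ (draws I G ω)) P :=
  have : OpensMeasurableSpace (ℕ → Fin b → Fin n × OGroup d) := inferInstance
  have : OpensMeasurableSpace (ℕ → ℕ → Fin b → Fin n × OGroup d) := Pi.opensMeasurableSpace
  (integrable_of_continuous_of_compactSpace hφ).comp_measurable hS.measurable_draws

theorem indepFun_iterate {f : Fin n → E d → ℝ} {h : E d → EReal} {γ : ℝ}
    (hf : ∀ i, Continuous (f i)) (hp : Continuous (prox h γ)) (ℓ m : ℕ) (β : ℕ → ℝ) (x₀ : E d)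
    (τ k : ℕ) :
    IndepFun (fun ω => (iterate f h γ ℓ m β x₀ τ 0 (draws I G ω),
      iterate f h γ ℓ m β x₀ τ k (draws I G ω))) (fun ω => draws I G ω τ k) P := by
  let past : Set (ℕ × ℕ × Fin b) := {s | s.1 < τ ∨ s.1 = τ ∧ s.2.1 < k}
  let current : Set (ℕ × ℕ × Fin b) := {s | s.1 = τ ∧ s.2.1 = k}
  let σ : ℕ × ℕ × Fin b → MeasurableSpace Ω := fun s =>
    MeasurableSpace.comap (fun ω => draws I G ω s.1 s.2.1 s.2.2) inferInstance
  have hdisj : Disjoint past current := by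
    rw [Set.disjoint_left]
    rintro s hs ⟨hτ, hk⟩
    rcases hs with hs | ⟨_, hs⟩ <;> omega
  have hle : ∀ s, σ s ≤ ‹MeasurableSpace Ω› := fun s =>
    (hS.measurable_draw s.1 s.2.1 s.2.2).comap_le
  have hσ : iIndep σ P := hS.indep_draws.iIndep
  have hindep : Indep (⨆ s ∈ past, σ s) (⨆ s ∈ current, σ s) P :=
    indep_iSup_of_disjoint hle hσ hdisj
  have hbatch : ∀ (S : Set (ℕ × ℕ × Fin b)) (τ' k' : ℕ), (∀ j, (τ', k', j) ∈ S) →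
      Measurable[⨆ s ∈ S, σ s] fun ω => draws I G ω τ' k' := fun S τ' k' hS =>
    @measurable_pi_lambda _ _ _ (_) _ _ fun j =>
      Measurable.mono (comap_measurable _) (le_iSup₂_of_le (τ', k', j) (hS j) le_rfl) le_rfl
  have hpast : ∀ k₁ ≤ k, Measurable[⨆ s ∈ past, σ s] fun ω =>
      iterate f h γ ℓ m β x₀ τ k₁ (draws I G ω) := fun k₁ hk₁ =>
    @measurable_iterate d n b f h γ ℓ m β x₀ hf hp Ω (⨆ s ∈ past, σ s) (draws I G) τ k₁
      fun τ' k' hlt => hbatch past τ' k' fun _ =>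
        hlt.imp_right fun hk' => ⟨hk'.1, hk'.2.trans_le hk₁⟩
  rw [IndepFun_iff_Indep]
  refine indep_of_indep_of_le_left (indep_of_indep_of_le_right hindep ?_) ?_
  · exact (hbatch current τ k fun _ => ⟨rfl, rfl⟩).comap_le
  · exact (@Measurable.prodMk _ (⨆ s ∈ past, σ s) _ _ _ _ _ _
      (hpast 0 k.zero_le) (hpast k le_rfl)).comap_le

end IsSampling

/-! ### Expected decrease of the gap in an inner step -/

/-- The factor of `‖x_k - x_0‖²` in the bound on the mean squared error of the search direction
at `x_k`. -/
noncomputable def varConst (L : ℝ) (d ℓ b : ℕ) : ℝ := 3 * L ^ 2 * d / (ℓ * b)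

theorem integral_norm_sq_searchDir_sub_gradient_le {d n b ℓ : ℕ} {Ω : Type*} [MeasurableSpace Ω]
    {P : Measure Ω} [IsProbabilityMeasure P] {I : Fin b → Ω → Fin n} {G : Fin b → Ω → OGroup d}
    {f : Fin n → E d → ℝ} {L β : ℝ} (hn : 0 < n) (hb : 0 < b) (hℓ : 0 < ℓ) (hℓd : ℓ ≤ d)
    (hf : IsSmoothFamily f L) (hβ : β ≠ 0) (hD : ∀ j, IsDraw P (I j) (G j))
    (hindep : iIndepFun (fun j ω => (I j ω, G j ω)) P) (x₀ x : E d) :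
    ∫ ω, ‖searchDir f ℓ β (fun j => (I j ω, G j ω)) x₀ x - gradient (avg f) x‖ ^ 2 ∂P
      ≤ varConst L d ℓ b * ‖x - x₀‖ ^ 2 + biasConst L d ℓ * β ^ 2 := by
  let ξ : Ω → Fin b → Fin n × OGroup d := fun ω j => (I j ω, G j ω)
  have hξ : Measurable ξ := measurable_pi_lambda _ fun j =>
    (hD j).measurable_index.prodMk (hD j).measurable_matrix
  let w := gradient (avg f) x - gradient (avg f) x₀
  have hsearch : Continuous fun ξ : Fin b → Fin n × OGroup d => searchDir f ℓ β ξ x₀ x :=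
    continuous_searchDir (fun i => (hf.differentiable i).continuous) ℓ β continuous_id
      continuous_const continuous_const
  have hint : Integrable (fun ω => ‖searchDir f ℓ β (ξ ω) x₀ x - gradient (avg f) x‖ ^ 2) P :=
    (integrable_of_continuous_of_compactSpace
      ((hsearch.sub continuous_const).norm.pow 2)).comp_measurable hξ
  have hint' : Integrable (fun ω => 3 * ‖sketchDir f ℓ (ξ ω) x₀ x - w‖ ^ 2) P :=
    ((integrable_of_continuous_of_compactSpace (((continuous_sketchDir_left f ℓ x₀ x).sub
      continuous_const).norm.pow 2)).comp_measurable hξ).const_mul 3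
  calc _ ≤ ∫ ω, (3 * ‖sketchDir f ℓ (ξ ω) x₀ x - w‖ ^ 2 + biasConst L d ℓ * β ^ 2) ∂P :=
        integral_mono hint (hint'.add (integrable_const _)) fun ω =>
          norm_sq_searchDir_sub_gradient_le hn hb hℓd hf hβ (ξ ω) x₀ x
    _ = 3 * ∫ ω, ‖sketchDir f ℓ (ξ ω) x₀ x - w‖ ^ 2 ∂P + biasConst L d ℓ * β ^ 2 := by
        rw [integral_add hint' (integrable_const _), integral_const_mul]
        simp
    _ ≤ 3 * (1 / b * ((d : ℝ) / ℓ * (L * ‖x - x₀‖) ^ 2)) + biasConst L d ℓ * β ^ 2 := by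
        gcongr
        exact integral_norm_sq_sketchDir_sub_le hn hb hℓ hℓd hf hD hindep x₀ x
    _ = varConst L d ℓ b * ‖x - x₀‖ ^ 2 + biasConst L d ℓ * β ^ 2 := by
        rw [varConst]; ring

/-- The standing assumptions on the problem and on the parameters of the algorithm. The last field
is the stepsize restriction in the form in which it is used: over the `m` steps of an inner loop,
the errors due to the variance are compensated by the decrease terms of the proximal steps. -/
structure IsAdmissible {d n : ℕ} (f : Fin n → E d → ℝ) (h : E d → EReal) (L μ γ : ℝ)
    (ℓ m b : ℕ) : Prop where
  n_pos : 0 < n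
  b_pos : 0 < b
  ℓ_pos : 0 < ℓ
  ℓ_le : ℓ ≤ d
  μ_pos : 0 < μ
  γ_pos : 0 < γ
  smooth : IsSmoothFamily f L
  convex : IsConvexExt h
  proximable : IsProximable h
  rpl : IsRPL f h γ μ
  mul_le_quarter : L * γ ≤ 1 / 4
  mul_lt_two : γ * μ < 2
  variance_le : γ / 2 * varConst L d ℓ b * m ^ 2 ≤ 3 / (8 * γ) * rate γ μ ^ m

namespace IsAdmissible

variable {d n b : ℕ} {Ω : Type*} [MeasurableSpace Ω] {P : Measure Ω} [IsProbabilityMeasure P]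
  {f : Fin n → E d → ℝ} {h : E d → EReal} {L μ γ : ℝ} {ℓ m : ℕ} {β : ℕ → ℝ} {x₀ : E d}
  {I : ℕ → ℕ → Fin b → Ω → Fin n} {G : ℕ → ℕ → Fin b → Ω → OGroup d}
  (hA : IsAdmissible f h L μ γ ℓ m b)
include hA

theorem continuous_component (i : Fin n) : Continuous (f i) :=
  (hA.smooth.differentiable i).continuous

variable (hx₀ : h x₀ ≠ ⊤)
include hx₀

theorem continuous_prox : Continuous (prox h γ) :=
  VRSZD.continuous_prox hA.convex hA.proximable hA.γ_pos hx₀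

variable (hS : IsSampling P I G)
include hS

theorem integrable_gap_iterate (τ k : ℕ) :
    Integrable (fun ω => gap f h (iterate f h γ ℓ m β x₀ τ k (draws I G ω))) P :=
  hS.integrable_comp_draws (continuous_gap_iterate hA.continuous_component
    (hA.continuous_prox hx₀)
    (continuous_gap_prox hA.convex hA.proximable hA.γ_pos hA.smooth hx₀) τ k)

theorem integrable_norm_sq_iterate_sub (τ k k' : ℕ) :
    Integrable (fun ω => ‖iterate f h γ ℓ m β x₀ τ k (draws I G ω)
      - iterate f h γ ℓ m β x₀ τ k' (draws I G ω)‖ ^ 2) P :=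
  have hcont : ∀ k, Continuous fun ξ : ℕ → ℕ → Fin b → Fin n × OGroup d =>
      iterate f h γ ℓ m β x₀ τ k ξ :=
    continuous_iterate hA.continuous_component (hA.continuous_prox hx₀) τ
  hS.integrable_comp_draws (((hcont k).sub (hcont k')).norm.pow 2)

theorem integrable_norm_sq_searchDir_iterate_sub (τ k : ℕ) :
    Integrable (fun ω => ‖searchDir f ℓ (β τ) (draws I G ω τ k)
        (iterate f h γ ℓ m β x₀ τ 0 (draws I G ω)) (iterate f h γ ℓ m β x₀ τ k (draws I G ω))
      - gradient (avg f) (iterate f h γ ℓ m β x₀ τ k (draws I G ω))‖ ^ 2) P := by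
  have hcont : ∀ k, Continuous fun ξ : ℕ → ℕ → Fin b → Fin n × OGroup d =>
      iterate f h γ ℓ m β x₀ τ k ξ :=
    continuous_iterate hA.continuous_component (hA.continuous_prox hx₀) τ
  have hsearch : Continuous fun ξ : ℕ → ℕ → Fin b → Fin n × OGroup d =>
      searchDir f ℓ (β τ) (ξ τ k) (iterate f h γ ℓ m β x₀ τ 0 ξ) (iterate f h γ ℓ m β x₀ τ k ξ) :=
    continuous_searchDir hA.continuous_component ℓ (β τ) (continuous_apply_apply τ k) (hcont 0)
      (hcont k)
  exact hS.integrable_comp_draws ((hsearch.sub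
    ((hA.smooth.continuous_gradient_avg hA.n_pos).comp (hcont k))).norm.pow 2)

theorem integral_norm_sq_searchDir_iterate_sub_le {τ : ℕ} (hβ : β τ ≠ 0) (k : ℕ) :
    ∫ ω, ‖searchDir f ℓ (β τ) (draws I G ω τ k)
        (iterate f h γ ℓ m β x₀ τ 0 (draws I G ω)) (iterate f h γ ℓ m β x₀ τ k (draws I G ω))
      - gradient (avg f) (iterate f h γ ℓ m β x₀ τ k (draws I G ω))‖ ^ 2 ∂P
      ≤ varConst L d ℓ b * ∫ ω, ‖iterate f h γ ℓ m β x₀ τ k (draws I G ω)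
          - iterate f h γ ℓ m β x₀ τ 0 (draws I G ω)‖ ^ 2 ∂P + biasConst L d ℓ * β τ ^ 2 := by
  let X : ℕ → Ω → E d := fun k ω => iterate f h γ ℓ m β x₀ τ k (draws I G ω)
  have hp := hA.continuous_prox hx₀
  have hX : ∀ k, Measurable (X k) := fun k =>
    measurable_iterate hA.continuous_component hp τ k fun τ' k' _ =>
      (measurable_pi_apply k').comp ((measurable_pi_apply τ').comp hS.measurable_draws)
  have hξ : Measurable fun ω => draws I G ω τ k :=
    (measurable_pi_apply k).comp ((measurable_pi_apply τ).comp hS.measurable_draws)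
  have hdist : Integrable (fun ω => varConst L d ℓ b * ‖X k ω - X 0 ω‖ ^ 2) P :=
    (hA.integrable_norm_sq_iterate_sub hx₀ hS τ k 0).const_mul _
  have herr : Continuous fun q : (E d × E d) × (Fin b → Fin n × OGroup d) =>
      searchDir f ℓ (β τ) q.2 q.1.1 q.1.2 - gradient (avg f) q.1.2 :=
    (continuous_searchDir hA.continuous_component ℓ (β τ) continuous_snd continuous_fst.fst
      continuous_fst.snd).sub
      ((hA.smooth.continuous_gradient_avg hA.n_pos).comp continuous_fst.snd)
  have hcond := integral_prodMk_le_of_indepFun ((hX 0).prodMk (hX k)) hξ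
    (hS.indepFun_iterate hA.continuous_component hp ℓ m β x₀ τ k)
    (φ := fun q => ‖searchDir f ℓ (β τ) q.2 q.1.1 q.1.2 - gradient (avg f) q.1.2‖ ^ 2)
    (herr.norm.pow 2).stronglyMeasurable
    (hA.integrable_norm_sq_searchDir_iterate_sub hx₀ hS τ k)
    (ψ := fun q => varConst L d ℓ b * ‖q.2 - q.1‖ ^ 2 + biasConst L d ℓ * β τ ^ 2)
    (Continuous.stronglyMeasurable (by fun_prop)) (hdist.add (integrable_const _)) fun q =>
      integral_norm_sq_searchDir_sub_gradient_le hA.n_pos hA.b_pos hA.ℓ_pos hA.ℓ_le hA.smooth hβ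
        (hS.isDraw τ k) (hS.iIndepFun_batch τ k) q.1 q.2
  rw [integral_add hdist (integrable_const _), integral_const_mul] at hcond
  simpa only [integral_const, probReal_univ, one_smul] using hcond

theorem integral_gap_iterate_succ_le {τ : ℕ} (hβ : β τ ≠ 0) (k : ℕ) :
    ∫ ω, gap f h (iterate f h γ ℓ m β x₀ τ (k + 1) (draws I G ω)) ∂P
      ≤ rate γ μ * ∫ ω, gap f h (iterate f h γ ℓ m β x₀ τ k (draws I G ω)) ∂P
        - 3 / (8 * γ) * ∫ ω, ‖iterate f h γ ℓ m β x₀ τ (k + 1) (draws I G ω)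
          - iterate f h γ ℓ m β x₀ τ k (draws I G ω)‖ ^ 2 ∂P
        + γ / 2 * varConst L d ℓ b * ∫ ω, ‖iterate f h γ ℓ m β x₀ τ k (draws I G ω)
          - iterate f h γ ℓ m β x₀ τ 0 (draws I G ω)‖ ^ 2 ∂P
        + γ / 2 * (biasConst L d ℓ * β τ ^ 2) := by
  let X : ℕ → Ω → E d := fun k ω => iterate f h γ ℓ m β x₀ τ k (draws I G ω)
  let err : Ω → ℝ := fun ω =>
    ‖searchDir f ℓ (β τ) (draws I G ω τ k) (X 0 ω) (X k ω) - gradient (avg f) (X k ω)‖ ^ 2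
  have hγ := hA.γ_pos
  have hgap : Integrable (fun ω => rate γ μ * gap f h (X k ω)) P :=
    (hA.integrable_gap_iterate hx₀ hS τ k).const_mul _
  have hstep : Integrable (fun ω => 3 / (8 * γ) * ‖X (k + 1) ω - X k ω‖ ^ 2) P :=
    (hA.integrable_norm_sq_iterate_sub hx₀ hS τ (k + 1) k).const_mul _
  have herr : Integrable (fun ω => γ / 2 * err ω) P :=
    (hA.integrable_norm_sq_searchDir_iterate_sub hx₀ hS τ k).const_mul _
  have hdecr : Integrable
      (fun ω => rate γ μ * gap f h (X k ω) - 3 / (8 * γ) * ‖X (k + 1) ω - X k ω‖ ^ 2) P :=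
    hgap.sub hstep
  have hpoint : ∀ ω, gap f h (X (k + 1) ω)
      ≤ rate γ μ * gap f h (X k ω) - 3 / (8 * γ) * ‖X (k + 1) ω - X k ω‖ ^ 2 + γ / 2 * err ω :=
    fun ω => gap_prox_le_of_isRPL hA.convex hA.proximable hA.γ_pos hA.n_pos hA.smooth
      hA.mul_le_quarter hA.rpl (iterate_ne_top hA.proximable hγ hx₀ τ k _) _
  calc ∫ ω, gap f h (X (k + 1) ω) ∂P
      ≤ ∫ ω, (rate γ μ * gap f h (X k ω) - 3 / (8 * γ) * ‖X (k + 1) ω - X k ω‖ ^ 2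
          + γ / 2 * err ω) ∂P :=
        integral_mono (hA.integrable_gap_iterate hx₀ hS τ (k + 1)) (hdecr.add herr) hpoint
    _ = rate γ μ * ∫ ω, gap f h (X k ω) ∂P
          - 3 / (8 * γ) * ∫ ω, ‖X (k + 1) ω - X k ω‖ ^ 2 ∂P + γ / 2 * ∫ ω, err ω ∂P := by
        rw [integral_add hdecr herr, integral_sub hgap hstep]
        simp only [integral_const_mul]
    _ ≤ _ := by
        rw [add_assoc _ (γ / 2 * varConst L d ℓ b * _), mul_assoc (γ / 2), ← mul_add]
        gcongr
        exact hA.integral_norm_sq_searchDir_iterate_sub_le hx₀ hS hβ k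

end IsAdmissible

/-! ### Contraction of the gap in an outer iteration -/

/-- The bookkeeping of an inner loop: the distances `r` from its starting point enter the recursion
with weight `A`, and the weight `c α^k - A m k` is what remains of the decrease terms `c s` after
paying for them. -/
theorem le_sub_mul_sum_of_inner_recursion {α A B c : ℝ} {a s r : ℕ → ℝ} {m : ℕ} (hα₀ : 0 ≤ α)
    (hα₁ : α ≤ 1) (hA : 0 ≤ A) (hc : 0 ≤ c) (hs : ∀ k, 0 ≤ s k)
    (hr : ∀ k, r k ≤ k * ∑ j ∈ Finset.range k, s j)
    (ha : ∀ k, a (k + 1) ≤ α * a k - c * s k + A * r k + B) {k : ℕ} (hk : k ≤ m) :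
    a k ≤ α ^ k * a 0 + B * ∑ j ∈ Finset.range k, α ^ j
      - (c * α ^ k - A * m * k) * ∑ j ∈ Finset.range k, s j := by
  induction k with
  | zero => simp
  | succ k ih =>
    let S := ∑ j ∈ Finset.range k, s j
    let w := c * α ^ (k + 1) - A * m * (k + 1)
    have hS : 0 ≤ S := Finset.sum_nonneg fun j _ => hs j
    have hkm : (k : ℝ) ≤ m := by exact_mod_cast (Nat.le_succ k).trans hk
    have hdist : A * r k ≤ A * m * S := by
      rw [mul_assoc]
      gcongr
      exact (hr k).trans (by gcongr)
    have hwS : w ≤ α * (c * α ^ k - A * m * k) - A * m := by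
      have : α * (A * m * k) ≤ A * m * k := mul_le_of_le_one_left (by positivity) hα₁
      simp only [w, pow_succ]
      linarith
    have hws : w ≤ c :=
      (sub_le_self _ (by positivity)).trans (mul_le_of_le_one_right hc (pow_le_one₀ hα₀ hα₁))
    calc a (k + 1) ≤ α * a k - c * s k + A * r k + B := ha k
      _ ≤ α * (α ^ k * a 0 + B * ∑ j ∈ Finset.range k, α ^ j - (c * α ^ k - A * m * k) * S)
          - c * s k + A * m * S + B := by
        gcongr
        exact ih ((Nat.le_succ k).trans hk)
      _ = α ^ (k + 1) * a 0 + B * ∑ j ∈ Finset.range (k + 1), α ^ j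
          - ((α * (c * α ^ k - A * m * k) - A * m) * S + c * s k) := by
        rw [geom_sum_succ, pow_succ]
        ring
      _ ≤ α ^ (k + 1) * a 0 + B * ∑ j ∈ Finset.range (k + 1), α ^ j - (w * S + w * s k) := by
        gcongr
        exact hs k
      _ = _ := by
        rw [Finset.sum_range_succ s, ← mul_add]
        push_cast
        rfl

theorem le_of_inner_recursion {α A B c : ℝ} {a s r : ℕ → ℝ} {m : ℕ} (hα₀ : 0 < α) (hα₁ : α ≤ 1)
    (hA : 0 ≤ A) (hAm : A * m ^ 2 ≤ c * α ^ m) (hs : ∀ k, 0 ≤ s k)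
    (hr : ∀ k, r k ≤ k * ∑ j ∈ Finset.range k, s j)
    (ha : ∀ k, a (k + 1) ≤ α * a k - c * s k + A * r k + B) :
    a m ≤ α ^ m * a 0 + B * ∑ k ∈ Finset.range m, α ^ k := by
  have hc : 0 ≤ c := nonneg_of_mul_nonneg_left ((by positivity : 0 ≤ A * (m : ℝ) ^ 2).trans hAm)
    (by positivity)
  have hrest : 0 ≤ (c * α ^ m - A * m * m) * ∑ j ∈ Finset.range m, s j :=
    mul_nonneg (by linarith) (Finset.sum_nonneg fun j _ => hs j)
  linarith [le_sub_mul_sum_of_inner_recursion hα₀.le hα₁ hA hc hs hr ha (le_refl m)]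

theorem norm_sub_sq_le_mul_sum {V : Type*} [SeminormedAddCommGroup V] (u : ℕ → V) (k : ℕ) :
    ‖u k - u 0‖ ^ 2 ≤ k * ∑ j ∈ Finset.range k, ‖u (j + 1) - u j‖ ^ 2 := by
  simpa only [Finset.sum_range_sub, Finset.card_range] using
    norm_sum_sq_le_card_mul_sum_sq (Finset.range k) fun j => u (j + 1) - u j

theorem one_sub_rate (γ μ : ℝ) : 1 - rate γ μ = γ * μ / 2 := by rw [rate, sub_sub_cancel]

theorem rate_pos {γ μ : ℝ} (h : γ * μ < 2) : 0 < rate γ μ := by rw [rate]; linarith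

theorem rate_le_one {γ μ : ℝ} (h : 0 ≤ γ * μ) : rate γ μ ≤ 1 := by rw [rate]; linarith

theorem errConst_nonneg (L : ℝ) {μ : ℝ} (hμ : 0 ≤ μ) (d ℓ : ℕ) : 0 ≤ errConst L μ d ℓ := by
  rw [errConst]; positivity

theorem errConst_pos {L μ : ℝ} {d : ℕ} (hL : L ≠ 0) (hμ : 0 < μ) (hd : 0 < d) (ℓ : ℕ) :
    0 < errConst L μ d ℓ := by
  rw [errConst]; positivity

theorem mul_errConst (L : ℝ) {μ : ℝ} (hμ : μ ≠ 0) (d ℓ : ℕ) :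
    μ * errConst L μ d ℓ = biasConst L d ℓ := by
  rw [errConst, biasConst]; field_simp; ring

namespace IsAdmissible

variable {d n b : ℕ} {Ω : Type*} [MeasurableSpace Ω] {P : Measure Ω} [IsProbabilityMeasure P]
  {f : Fin n → E d → ℝ} {h : E d → EReal} {L μ γ : ℝ} {ℓ m : ℕ} {x₀ : E d}
  {I : ℕ → ℕ → Fin b → Ω → Fin n} {G : ℕ → ℕ → Fin b → Ω → OGroup d}
  (hA : IsAdmissible f h L μ γ ℓ m b) (hx₀ : h x₀ ≠ ⊤) (hS : IsSampling P I G)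
include hA hx₀ hS

theorem integral_norm_sq_iterate_sub_le_sum {β : ℕ → ℝ} (τ k : ℕ) :
    ∫ ω, ‖iterate f h γ ℓ m β x₀ τ k (draws I G ω)
        - iterate f h γ ℓ m β x₀ τ 0 (draws I G ω)‖ ^ 2 ∂P
      ≤ k * ∑ j ∈ Finset.range k, ∫ ω, ‖iterate f h γ ℓ m β x₀ τ (j + 1) (draws I G ω)
        - iterate f h γ ℓ m β x₀ τ j (draws I G ω)‖ ^ 2 ∂P := by
  have hstep : ∀ j ∈ Finset.range k, Integrable (fun ω =>
      ‖iterate f h γ ℓ m β x₀ τ (j + 1) (draws I G ω)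
        - iterate f h γ ℓ m β x₀ τ j (draws I G ω)‖ ^ 2) P := fun j _ =>
    hA.integrable_norm_sq_iterate_sub hx₀ hS τ (j + 1) j
  rw [← integral_finsetSum _ hstep, ← integral_const_mul]
  exact integral_mono (hA.integrable_norm_sq_iterate_sub hx₀ hS τ k 0)
    ((integrable_finsetSum _ hstep).const_mul _) fun ω =>
      norm_sub_sq_le_mul_sum (fun j => iterate f h γ ℓ m β x₀ τ j (draws I G ω)) k

theorem integral_gap_outerIter_succ_le {β : ℕ → ℝ} {τ : ℕ} (hβ : β τ ≠ 0) :
    ∫ ω, gap f h (outerIter f h γ ℓ m β (draws I G ω) x₀ (τ + 1)) ∂P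
      ≤ rate γ μ ^ m * ∫ ω, gap f h (outerIter f h γ ℓ m β (draws I G ω) x₀ τ) ∂P
        + (1 - rate γ μ ^ m) * (errConst L μ d ℓ * β τ ^ 2) := by
  have hγ := hA.γ_pos
  have hvar : 0 ≤ γ / 2 * varConst L d ℓ b := by rw [varConst]; positivity
  have hloop : ∫ ω, gap f h (iterate f h γ ℓ m β x₀ τ m (draws I G ω)) ∂P
      ≤ rate γ μ ^ m * ∫ ω, gap f h (iterate f h γ ℓ m β x₀ τ 0 (draws I G ω)) ∂P
        + γ / 2 * (biasConst L d ℓ * β τ ^ 2) * ∑ k ∈ Finset.range m, rate γ μ ^ k :=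
    le_of_inner_recursion (rate_pos hA.mul_lt_two) (rate_le_one (mul_pos hγ hA.μ_pos).le) hvar
      hA.variance_le (a := fun k => ∫ ω, gap f h (iterate f h γ ℓ m β x₀ τ k (draws I G ω)) ∂P)
      (fun k => integral_nonneg fun ω => by positivity)
      (hA.integral_norm_sq_iterate_sub_le_sum hx₀ hS τ)
      (hA.integral_gap_iterate_succ_le hx₀ hS hβ)
  have hbias : γ / 2 * (biasConst L d ℓ * β τ ^ 2) * ∑ k ∈ Finset.range m, rate γ μ ^ k
      = (1 - rate γ μ ^ m) * (errConst L μ d ℓ * β τ ^ 2) := by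
    rw [← mul_neg_geom_sum, one_sub_rate, ← mul_errConst L hA.μ_pos.ne']
    ring
  exact hbias ▸ hloop

theorem integral_gap_outerIter_le_of_geometric {β η : ℕ → ℝ} (hβ : ∀ τ, β τ ≠ 0)
    (hη : ∀ τ, β τ ^ 2 = rate γ μ ^ (m * (τ + 1)) * η τ ^ 2) (τ : ℕ) :
    ∫ ω, gap f h (outerIter f h γ ℓ m β (draws I G ω) x₀ τ) ∂P
      ≤ rate γ μ ^ (m * τ)
        * (gap f h x₀ + errConst L μ d ℓ * ∑ t ∈ Finset.range τ, η t ^ 2) := by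
  have hα := rate_pos hA.mul_lt_two
  have hE := errConst_nonneg L hA.μ_pos.le d ℓ
  induction τ with
  | zero => simp [outerIter]
  | succ τ ih =>
    have hβη : β τ ^ 2 = rate γ μ ^ m * (rate γ μ ^ (m * τ) * η τ ^ 2) := by
      rw [hη, ← mul_assoc, ← pow_add, mul_add_one, add_comm]
    calc _ ≤ rate γ μ ^ m * ∫ ω, gap f h (outerIter f h γ ℓ m β (draws I G ω) x₀ τ) ∂P
          + (1 - rate γ μ ^ m) * (errConst L μ d ℓ * β τ ^ 2) :=
        hA.integral_gap_outerIter_succ_le hx₀ hS (hβ τ)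
      _ ≤ rate γ μ ^ m * (rate γ μ ^ (m * τ)
            * (gap f h x₀ + errConst L μ d ℓ * ∑ t ∈ Finset.range τ, η t ^ 2))
          + 1 * (errConst L μ d ℓ * β τ ^ 2) := by
        gcongr
        exact sub_le_self 1 (by positivity)
      _ = _ := by
        rw [hβη, Finset.sum_range_succ, mul_add_one, pow_add]
        ring

theorem integral_gap_outerIter_le_of_const {β : ℝ} (hβ : β ≠ 0) (τ : ℕ) :
    ∫ ω, gap f h (outerIter f h γ ℓ m (fun _ => β) (draws I G ω) x₀ τ) ∂P
      ≤ rate γ μ ^ (m * τ) * gap f h x₀ + errConst L μ d ℓ * β ^ 2 := by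
  have hα := rate_pos hA.mul_lt_two
  have hE := errConst_nonneg L hA.μ_pos.le d ℓ
  induction τ with
  | zero =>
    have : 0 ≤ errConst L μ d ℓ * β ^ 2 := by positivity
    simpa [outerIter] using this
  | succ τ ih =>
    calc _ ≤ rate γ μ ^ m * ∫ ω, gap f h (outerIter f h γ ℓ m (fun _ => β) (draws I G ω) x₀ τ) ∂P
          + (1 - rate γ μ ^ m) * (errConst L μ d ℓ * β ^ 2) :=
        hA.integral_gap_outerIter_succ_le hx₀ hS hβ
      _ ≤ rate γ μ ^ m * (rate γ μ ^ (m * τ) * gap f h x₀ + errConst L μ d ℓ * β ^ 2)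
          + (1 - rate γ μ ^ m) * (errConst L μ d ℓ * β ^ 2) := by gcongr
      _ = _ := by
        rw [mul_add_one, pow_add]
        ring

theorem expectedGapLE_outerIter {β : ℕ → ℝ} {τ : ℕ} {B : ℝ}
    (hB : ∫ ω, gap f h (outerIter f h γ ℓ m β (draws I G ω) x₀ τ) ∂P ≤ B) :
    ExpectedGapLE P f h (fun ω => outerIter f h γ ℓ m β (draws I G ω) x₀ τ) B :=
  ⟨ae_of_all _ fun ω =>
    objective_ne_top_iff.2 (iterate_ne_top hA.proximable hA.γ_pos hx₀ τ 0 (draws I G ω)),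
    hA.integrable_gap_iterate hx₀ hS τ 0, hB⟩

theorem expectedGapLE_outerIter_of_geometric {η : ℕ → ℝ} {C : ℝ} (hη : ∀ τ, 0 < η τ)
    (hsum : Summable fun τ => η τ ^ 2) (hC : ∑' τ, η τ ^ 2 ≤ C) (τ : ℕ) :
    ExpectedGapLE P f h
      (fun ω => outerIter f h γ ℓ m (fun t => rate γ μ ^ ((m : ℝ) * (t + 1) / 2) * η t)
        (draws I G ω) x₀ τ)
      (rate γ μ ^ (m * τ) * (gap f h x₀ + errConst L μ d ℓ * C)) := by
  have hα := rate_pos hA.mul_lt_two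
  have hE := errConst_nonneg L hA.μ_pos.le d ℓ
  have hβ : ∀ t : ℕ, rate γ μ ^ ((m : ℝ) * (t + 1) / 2) * η t ≠ 0 := fun t =>
    (mul_pos (Real.rpow_pos_of_pos hα _) (hη t)).ne'
  have hβη : ∀ t : ℕ, (rate γ μ ^ ((m : ℝ) * (t + 1) / 2) * η t) ^ 2
      = rate γ μ ^ (m * (t + 1)) * η t ^ 2 := fun t => by
    have hexp : (m : ℝ) * (t + 1) / 2 * (2 : ℕ) = (m * (t + 1) : ℕ) := by push_cast; ring
    rw [mul_pow, ← Real.rpow_mul_natCast hα.le, hexp, Real.rpow_natCast]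
  refine hA.expectedGapLE_outerIter hx₀ hS
    ((hA.integral_gap_outerIter_le_of_geometric hx₀ hS hβ hβη τ).trans ?_)
  gcongr
  exact (hsum.sum_le_tsum _ fun t _ => sq_nonneg (η t)).trans hC

theorem expectedGapLE_outerIter_of_const {β : ℝ} (hβ : β ≠ 0) (τ : ℕ) :
    ExpectedGapLE P f h (fun ω => outerIter f h γ ℓ m (fun _ => β) (draws I G ω) x₀ τ)
      (rate γ μ ^ (m * τ) * gap f h x₀ + errConst L μ d ℓ * β ^ 2) :=
  hA.expectedGapLE_outerIter hx₀ hS (hA.integral_gap_outerIter_le_of_const hx₀ hS hβ τ)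

end IsAdmissible

/-! ### The stepsize restrictions -/

section Stepsize

variable {L μ γ : ℝ} {d ℓ m b : ℕ}

theorem mul_mul_lt_two (hμ : 0 < μ) (hrate : γ < 2 / μ * (1 / (2 * m + 1))) :
    γ * μ * (2 * m + 1) < 2 := by
  rw [div_mul_div_comm, mul_one, lt_div_iff₀ (by positivity)] at hrate
  linarith

theorem mul_lt_two_of_mul_lt_two (h₀ : 0 ≤ γ * μ) (h : γ * μ * (2 * m + 1) < 2) : γ * μ < 2 :=
  (le_mul_of_one_le_right h₀ (by linarith [m.cast_nonneg (α := ℝ)])).trans_lt h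

theorem theta_pos (h : γ * μ * (2 * m + 1) < 2) : 0 < theta γ μ m := by
  rw [theta]; linarith

theorem theta_le_rate_pow (h₀ : 0 ≤ γ * μ) (h : γ * μ ≤ 4) (m : ℕ) :
    theta γ μ m ≤ rate γ μ ^ m := by
  have hbernoulli := one_add_mul_le_pow (a := -(γ * μ / 2)) (by linarith) m
  have : 0 ≤ γ * μ * m := by positivity
  rw [theta, rate, sub_eq_add_neg 1 (γ * μ / 2)]
  linarith

theorem sq_mul_le_of_lt_sqrt_mul_sqrt {θ : ℝ} (hd : 0 < d) (hm : 0 < m) (hL : 0 < L)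
    (hγ : 0 ≤ γ) (hθ : 0 ≤ θ) (hbatch : γ < √(b * θ) / (10 * m * L) * √(ℓ / d)) :
    γ ^ 2 * (100 * m ^ 2 * L ^ 2 * d) ≤ b * ℓ * θ := by
  have hsq : γ ^ 2 ≤ b * θ / (10 * m * L) ^ 2 * (ℓ / d) := by
    calc γ ^ 2 ≤ (√(b * θ) / (10 * m * L) * √(ℓ / d)) ^ 2 := by gcongr
      _ = _ := by
        rw [mul_pow, div_pow, Real.sq_sqrt (by positivity), Real.sq_sqrt (by positivity)]
  calc _ ≤ b * θ / (10 * m * L) ^ 2 * (ℓ / d) * (100 * m ^ 2 * L ^ 2 * d) := by gcongr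
    _ = b * ℓ * θ := by field_simp; ring

theorem half_mul_varConst_mul_sq_le (hb : 0 < b) (hm : 0 < m) (hℓ : 0 < ℓ) (hd : 0 < d)
    (hL : 0 < L) (hμ : 0 < μ) (hγ : 0 < γ) (hrate : γ * μ * (2 * m + 1) < 2)
    (hbatch : γ < √(b * theta γ μ m) / (10 * m * L) * √(ℓ / d)) :
    γ / 2 * varConst L d ℓ b * m ^ 2 ≤ 3 / (8 * γ) * rate γ μ ^ m := by
  have hγμ : 0 ≤ γ * μ := (mul_pos hγ hμ).le
  have hθ : theta γ μ m ≤ rate γ μ ^ m :=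
    theta_le_rate_pow hγμ (by linarith [mul_lt_two_of_mul_lt_two hγμ hrate]) m
  have hsq := sq_mul_le_of_lt_sqrt_mul_sqrt hd hm hL hγ.le (theta_pos hrate).le hbatch
  have hvar : γ ^ 2 * (4 * m ^ 2 * L ^ 2 * d) / (b * ℓ) ≤ rate γ μ ^ m := by
    rw [div_le_iff₀' (by positivity)]
    calc _ ≤ γ ^ 2 * (100 * m ^ 2 * L ^ 2 * d) := by gcongr; norm_num
      _ ≤ b * ℓ * theta γ μ m := hsq
      _ ≤ b * ℓ * rate γ μ ^ m := by gcongr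
  calc _ = 3 / (8 * γ) * (γ ^ 2 * (4 * m ^ 2 * L ^ 2 * d) / (b * ℓ)) := by
        rw [varConst]; field_simp; norm_num
    _ ≤ _ := by gcongr

end Stepsize

/-! ### The number of function evaluations -/

namespace Prog

variable {n d b : ℕ} {α β : Type}

theorem evals_bind (f : Fin n → E d → ℝ) (p : Prog n d α) (q : α → Prog n d β) :
    (p >>= q).evals f = p.evals f + (q (p.run f)).evals f := by
  change (andThen p q).evals f = _
  induction p with
  | ret a => simp [andThen, evals, run]
  | query i x k ih => simp only [andThen, evals, run, ih]; ring

theorem evals_pure (f : Fin n → E d → ℝ) (a : α) : (pure a : Prog n d α).evals f = 0 := rfl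

theorem evals_sumOver {ι : Type} [AddMonoid α] (f : Fin n → E d → ℝ) (l : List ι)
    (p : ι → Prog n d α) {c : ℕ} (hp : ∀ i, (p i).evals f = c) :
    (sumOver l p).evals f = l.length * c := by
  induction l with
  | nil => simp [sumOver, evals]
  | cons a l ih => simp [sumOver, evals_bind, evals_pure, hp, ih]; ring

theorem evals_eval (f : Fin n → E d → ℝ) (i : Fin n) (x : E d) : (eval i x).evals f = 1 := rfl

theorem evals_evalAvg (f : Fin n → E d → ℝ) (x : E d) : (evalAvg x).evals f = n := by
  simp [evalAvg, evals_bind, evals_pure, evals_sumOver f _ _ fun i => evals_eval f i x]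

theorem evals_fullApprox (f : Fin n → E d → ℝ) (β : ℝ) (x : E d) :
    (fullApprox β x).evals f = n * (d + 1) := by
  rw [fullApprox, evals_bind, evals_evalAvg, evals_sumOver f _ _ (c := n) fun j => by
    simp [evals_bind, evals_pure, evals_evalAvg], List.length_finRange]
  ring

theorem length_filter_val_lt {ℓ : ℕ} (hℓd : ℓ ≤ d) :
    ((List.finRange d).filter fun j => j.val < ℓ).length = ℓ := by
  have h := card_filter_val_lt_eq hℓd
  rwa [Finset.card_def, Finset.filter_val] at h

theorem evals_stochApprox (f : Fin n → E d → ℝ) {ℓ : ℕ} (hℓd : ℓ ≤ d) (β : ℝ) (i : Fin n)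
    (G : OGroup d) (x : E d) : (stochApprox ℓ β i G x).evals f = ℓ + 1 := by
  rw [stochApprox, evals_bind, evals_eval, evals_bind, evals_pure,
    evals_sumOver f _ _ (c := 1) fun j => by simp [evals_bind, evals_pure, evals_eval],
    length_filter_val_lt hℓd]
  ring

theorem evals_inner (f : Fin n → E d → ℝ) (h : E d → EReal) (γ : ℝ) {ℓ : ℕ} (hℓd : ℓ ≤ d) (β : ℝ)
    (ξ : ℕ → Fin b → Fin n × OGroup d) (g x₀ : E d) (k : ℕ) :
    (inner h γ ℓ β ξ g x₀ k).evals f = k * (b * (2 * (ℓ + 1))) := by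
  induction k with
  | zero => simp [inner, evals_pure]
  | succ k ih =>
    rw [inner, evals_bind, ih, evals_bind, evals_pure,
      evals_sumOver f _ _ (c := 2 * (ℓ + 1)) fun j => by
        simp only [evals_bind, evals_pure, evals_stochApprox f hℓd]; ring, List.length_finRange]
    ring

theorem evals_outerStep (f : Fin n → E d → ℝ) (h : E d → EReal) (γ : ℝ) {ℓ : ℕ} (hℓd : ℓ ≤ d)
    (m : ℕ) (β : ℝ) (ξ : ℕ → Fin b → Fin n × OGroup d) (x₀ : E d) :
    (outerStep h γ ℓ m β ξ x₀).evals f = n * (d + 1) + m * (b * (2 * (ℓ + 1))) := by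
  rw [outerStep, evals_bind, evals_fullApprox, evals_inner f h γ hℓd]

theorem evals_outer (f : Fin n → E d → ℝ) (h : E d → EReal) (γ : ℝ) {ℓ : ℕ} (hℓd : ℓ ≤ d)
    (m : ℕ) (β : ℕ → ℝ) (ξ : ℕ → ℕ → Fin b → Fin n × OGroup d) (x₀ : E d) (τ : ℕ) :
    (outer h γ ℓ m β ξ x₀ τ).evals f = τ * (n * (d + 1) + m * (b * (2 * (ℓ + 1)))) := by
  induction τ with
  | zero => simp [outer, evals_pure]
  | succ τ ih => rw [outer, evals_bind, ih, evals_outerStep f h γ hℓd]; ring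

theorem evals_vrszd (f : Fin n → E d → ℝ) (h : E d → EReal) (γ : ℝ) {ℓ : ℕ} (hℓd : ℓ ≤ d)
    (m : ℕ) (β : ℕ → ℝ) (ξ : ℕ → ℕ → Fin b → Fin n × OGroup d) (x₀ : E d) (T : ℕ) :
    (vrszd h γ ℓ m β ξ x₀ T).evals f
      = (T + 1) * (n * (d + 1) + m * (b * (2 * (ℓ + 1)))) := by
  rw [vrszd, evals_bind, evals_bind, evals_pure, evals_outer f h γ hℓd,
    evals_outerStep f h γ hℓd]
  ring

end Prog

/-! ### The complexity bound -/

/-- The constant `K` of the complexity bound: `K / (m γ μ) · log (1/ε)` outer iterations bring an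
initial gap `D` below `ε`, for every `ε ≤ ε₀`. The maximum is the least multiple of `log (1/ε)` that
always exceeds `log (2 D)`. -/
noncomputable def iterFactor (D ε₀ : ℝ) : ℝ :=
  2 + 2 * max 0 (Real.log (2 * D) / Real.log (1 / ε₀))

/-- The constant `K'` of the complexity bound for the number of function evaluations. The term
`2 / |log (1/ε₀)|` accounts for rounding up the number of outer iterations and for the last one,
whose result is discarded. -/
noncomputable def evalFactor (D ε₀ : ℝ) : ℝ :=
  4 * (iterFactor D ε₀ + 2 / |Real.log (1 / ε₀)|)

theorem iterFactor_pos (D ε₀ : ℝ) : 0 < iterFactor D ε₀ := by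
  have := le_max_left 0 (Real.log (2 * D) / Real.log (1 / ε₀))
  rw [iterFactor]; linarith

theorem evalFactor_pos (D ε₀ : ℝ) : 0 < evalFactor D ε₀ := by
  have := iterFactor_pos D ε₀
  rw [evalFactor]; positivity

section Log

variable {D ε₀ ε : ℝ}

theorem log_one_div_pos (hε : 0 < ε) (hε1 : ε < 1) : 0 < Real.log (1 / ε) :=
  Real.log_pos ((one_lt_div hε).2 hε1)

theorem log_one_div_le (hε : 0 < ε) (hle : ε ≤ ε₀) : Real.log (1 / ε₀) ≤ Real.log (1 / ε) :=
  Real.log_le_log (one_div_pos.2 (hε.trans_le hle)) (one_div_le_one_div_of_le hε hle)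

theorem log_two_mul_le_max_mul_log (hε₀ : ε₀ < 1) (hε : 0 < ε) (hle : ε ≤ ε₀) :
    Real.log (2 * D)
      ≤ max 0 (Real.log (2 * D) / Real.log (1 / ε₀)) * Real.log (1 / ε) := by
  have hlog₀ := log_one_div_pos (hε.trans_le hle) hε₀
  have hlog := log_one_div_le hε hle
  calc Real.log (2 * D) = Real.log (2 * D) / Real.log (1 / ε₀) * Real.log (1 / ε₀) := by
        field_simp
    _ ≤ max 0 (Real.log (2 * D) / Real.log (1 / ε₀)) * Real.log (1 / ε) := by
        gcongr
        exact le_max_right _ _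

theorem exp_neg_mul_le_half {y : ℝ} (hD : 0 ≤ D) (hε₀ : ε₀ < 1) (hε : 0 < ε) (hle : ε ≤ ε₀)
    (hy : iterFactor D ε₀ * Real.log (1 / ε) ≤ 2 * y) : Real.exp (-y) * D ≤ ε / 2 := by
  obtain rfl | hD := hD.eq_or_lt
  · rw [mul_zero]; positivity
  have hexponent : -y ≤ Real.log ε - Real.log (2 * D) := by
    have hmax := log_two_mul_le_max_mul_log (D := D) hε₀ hε hle
    rw [iterFactor] at hy
    rw [one_div ε, Real.log_inv] at hmax hy
    linarith
  calc Real.exp (-y) * D ≤ Real.exp (Real.log ε - Real.log (2 * D)) * D := by gcongr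
    _ = ε / 2 := by
      rw [Real.exp_sub, Real.exp_log hε, Real.exp_log (by positivity)]
      field_simp

theorem ceil_add_one_le {K q : ℝ} (hK : 0 ≤ K) (hq : 0 < q) (hq₁ : q ≤ 1) (hε₀ : ε₀ < 1)
    (hε : 0 < ε) (hle : ε ≤ ε₀) :
    (⌈K * (1 / q * Real.log (1 / ε))⌉₊ + 1 : ℝ)
      ≤ (K + 2 / |Real.log (1 / ε₀)|) * (1 / q * Real.log (1 / ε)) := by
  have hlog₀ := log_one_div_pos (hε.trans_le hle) hε₀
  have hlog : Real.log (1 / ε₀) ≤ 1 / q * Real.log (1 / ε) :=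
    (log_one_div_le hε hle).trans
      (le_mul_of_one_le_left (hlog₀.le.trans (log_one_div_le hε hle)) ((one_le_div hq).2 hq₁))
  have hceil := Nat.ceil_lt_add_one (mul_nonneg hK (hlog₀.le.trans hlog))
  have hround : 2 ≤ 2 / |Real.log (1 / ε₀)| * (1 / q * Real.log (1 / ε)) := by
    rw [abs_of_pos hlog₀, div_mul_eq_mul_div, le_div_iff₀ hlog₀]
    gcongr
  linarith

end Log

theorem rate_pow_le_exp {γ μ : ℝ} (h : 0 ≤ rate γ μ) (k : ℕ) :
    rate γ μ ^ k ≤ Real.exp (-(γ * μ / 2 * k)) := by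
  have hrate : rate γ μ ≤ Real.exp (-(γ * μ / 2)) := by
    rw [rate, sub_eq_neg_add]
    exact Real.add_one_le_exp _
  calc _ ≤ Real.exp (-(γ * μ / 2)) ^ k := by gcongr
    _ = _ := by rw [← Real.exp_nat_mul]; ring_nf

theorem evals_outerStep_le {d ℓ : ℕ} (n m b : ℕ) (hd : 1 ≤ d) (hℓ : 1 ≤ ℓ) :
    n * (d + 1) + m * (b * (2 * (ℓ + 1))) ≤ 4 * (n * d + m * (b * ℓ)) := by
  have hd' : d + 1 ≤ 4 * d := by omega
  have hℓ' : 2 * (ℓ + 1) ≤ 4 * ℓ := by omega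
  calc _ ≤ n * (4 * d) + m * (b * (4 * ℓ)) :=
        add_le_add (Nat.mul_le_mul_left n hd') (Nat.mul_le_mul_left m (Nat.mul_le_mul_left b hℓ'))
    _ = _ := by ring

theorem evals_vrszd_le {d n b : ℕ} (f : Fin n → E d → ℝ) (h : E d → EReal) {γ μ : ℝ} {ℓ m : ℕ}
    (β : ℕ → ℝ) (ξ : ℕ → ℕ → Fin b → Fin n × OGroup d) (x₀ : E d) {D ε₀ ε : ℝ} (hm : 0 < m)
    (hℓ : 1 ≤ ℓ) (hℓd : ℓ ≤ d) (hγ : 0 < γ) (hμ : 0 < μ) (hrate : m * γ * μ ≤ 1) (hε₀ : ε₀ < 1)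
    (hε : 0 < ε) (hle : ε ≤ ε₀) :
    ((Prog.vrszd h γ ℓ m β ξ x₀
        ⌈iterFactor D ε₀ * (1 / (m * γ * μ) * Real.log (1 / ε))⌉₊).evals f : ℝ)
      ≤ evalFactor D ε₀ * ((n * d / (γ * μ * m) + b * ℓ / (γ * μ)) * Real.log (1 / ε)) := by
  have hcost : (n * (d + 1) + m * (b * (2 * (ℓ + 1))) : ℝ) ≤ 4 * (n * d + m * (b * ℓ)) := by
    exact_mod_cast evals_outerStep_le n m b (hℓ.trans hℓd) hℓ
  have hT := ceil_add_one_le (iterFactor_pos D ε₀).le (by positivity) hrate hε₀ hε hle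
  rw [Prog.evals_vrszd f h γ hℓd]
  push_cast
  calc _ ≤ (iterFactor D ε₀ + 2 / |Real.log (1 / ε₀)|) * (1 / (m * γ * μ) * Real.log (1 / ε))
          * (4 * (n * d + m * (b * ℓ))) :=
        mul_le_mul hT hcost (by positivity) ((by positivity : (0 : ℝ) ≤ _).trans hT)
    _ = _ := by
        rw [evalFactor]
        field_simp

namespace IsAdmissible

variable {d n b : ℕ} {f : Fin n → E d → ℝ} {h : E d → EReal} {L μ γ : ℝ} {ℓ m : ℕ} {x₀ : E d}

theorem of_stepsize_lt (hn : 0 < n) (hb : 0 < b) (hm : 0 < m) (hℓ : 0 < ℓ) (hℓd : ℓ ≤ d)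
    (hL : 0 < L) (hμ : 0 < μ) (hγ : 0 < γ) (hf : IsSmoothFamily f L) (hconv : IsConvexExt h)
    (hprox : IsProximable h) (hrpl : IsRPL f h γ μ) (hsmooth : γ < 1 / (4 * L))
    (hrate : γ * μ * (2 * m + 1) < 2)
    (hbatch : γ < √(b * theta γ μ m) / (10 * m * L) * √(ℓ / d)) :
    IsAdmissible f h L μ γ ℓ m b where
  n_pos := hn
  b_pos := hb
  ℓ_pos := hℓ
  ℓ_le := hℓd
  μ_pos := hμ
  γ_pos := hγ
  smooth := hf
  convex := hconv
  proximable := hprox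
  rpl := hrpl
  mul_le_quarter := by
    rw [lt_div_iff₀ (by positivity)] at hsmooth
    linarith
  mul_lt_two := mul_lt_two_of_mul_lt_two (mul_pos hγ hμ).le hrate
  variance_le := half_mul_varConst_mul_sq_le hb hm hℓ (hℓ.trans_le hℓd) hL hμ hγ hrate hbatch

theorem rate_pow_mul_le_half (hA : IsAdmissible f h L μ γ ℓ m b) {D ε₀ ε : ℝ} (hm : 0 < m)
    (hD : 0 ≤ D) (hε₀ : ε₀ < 1) (hε : 0 < ε) (hle : ε ≤ ε₀) {T : ℕ}
    (hT : iterFactor D ε₀ * (1 / (m * γ * μ) * Real.log (1 / ε)) ≤ T) :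
    rate γ μ ^ (m * T) * D ≤ ε / 2 := by
  have hγ := hA.γ_pos
  have hμ := hA.μ_pos
  have hT' : iterFactor D ε₀ * Real.log (1 / ε) ≤ 2 * (γ * μ / 2 * (m * T : ℕ)) := by
    calc _ = iterFactor D ε₀ * (1 / (m * γ * μ) * Real.log (1 / ε)) * (m * γ * μ) := by
          field_simp
      _ ≤ T * (m * γ * μ) := by gcongr
      _ = _ := by push_cast; ring
  exact (mul_le_mul_of_nonneg_right (rate_pow_le_exp (rate_pos hA.mul_lt_two).le _) hD).trans
    (exp_neg_mul_le_half hD hε₀ hε hle hT')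

theorem expectedGapLE_vrszd {Ω : Type*} [MeasurableSpace Ω] {P : Measure Ω}
    [IsProbabilityMeasure P] {I : ℕ → ℕ → Fin b → Ω → Fin n}
    {G : ℕ → ℕ → Fin b → Ω → OGroup d} (hA : IsAdmissible f h L μ γ ℓ m b) (hx₀ : h x₀ ≠ ⊤)
    (hS : IsSampling P I G) (hm : 0 < m) (hL : L ≠ 0) (hgap : 0 ≤ gap f h x₀) {ε₀ ε : ℝ}
    (hε₀ : ε₀ < 1) (hε : 0 < ε) (hle : ε ≤ ε₀) {T : ℕ}
    (hT : iterFactor (gap f h x₀) ε₀ * (1 / (m * γ * μ) * Real.log (1 / ε)) ≤ T) :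
    ExpectedGapLE P f h (fun ω => (Prog.vrszd h γ ℓ m
      (fun _ => √(ε / (2 * errConst L μ d ℓ))) (draws I G ω) x₀ T).run f) ε := by
  have hE := errConst_pos hL hA.μ_pos (hA.ℓ_pos.trans_le hA.ℓ_le) ℓ
  have hβ : √(ε / (2 * errConst L μ d ℓ)) ≠ 0 := by positivity
  have hinit : rate γ μ ^ (m * T) * gap f h x₀ ≤ ε / 2 :=
    hA.rate_pow_mul_le_half hm hgap hε₀ hε hle hT
  have hbias : errConst L μ d ℓ * √(ε / (2 * errConst L μ d ℓ)) ^ 2 = ε / 2 := by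
    rw [Real.sq_sqrt (by positivity)]
    field_simp
  simp only [Prog.run_vrszd]
  refine hA.expectedGapLE_outerIter hx₀ hS
    ((hA.integral_gap_outerIter_le_of_const hx₀ hS hβ T).trans ?_)
  linarith

end IsAdmissible

end VRSZD

theorem corollary2 :
    -- `K` and `K'` take the initial gap and an upper bound `ε₀ < 1` on the accuracies
    ∃ K K' : ℝ → ℝ → ℝ, (∀ D ε₀, 0 < K D ε₀ ∧ 0 < K' D ε₀) ∧
    ∀ {d n b : ℕ} {Ω : Type*} [MeasurableSpace Ω] (P : MeasureTheory.Measure Ω)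
      [MeasureTheory.IsProbabilityMeasure P]
      (f : Fin n → VRSZD.E d → ℝ) (h : VRSZD.E d → EReal) (L μ γ : ℝ) (ℓ m : ℕ)
      (I : ℕ → ℕ → Fin b → Ω → Fin n) (G : ℕ → ℕ → Fin b → Ω → VRSZD.OGroup d)
      (x₀ : VRSZD.E d),
      0 < n → 0 < b → 0 < m → 1 ≤ ℓ → ℓ ≤ d → 0 < L → 0 < μ → 0 < γ →
      VRSZD.IsSmoothFamily f L → VRSZD.IsConvexExt h → VRSZD.IsProximable h →
      (∃ z, ∀ x, VRSZD.objective f h z ≤ VRSZD.objective f h x) →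
      VRSZD.IsRPL f h γ μ →
      γ < 1 / (4 * L) → γ < 2 / μ * (1 / (2 * m + 1)) →
      γ < Real.sqrt (b * VRSZD.theta γ μ m) / (10 * m * L) * Real.sqrt (ℓ / d) →
      VRSZD.objective f h x₀ ≠ ⊤ →
      VRSZD.IsSampling P I G →
      -- (i)
      (∀ (η : ℕ → ℝ) (C : ℝ), (∀ τ, 0 < η τ) → Summable (fun τ => η τ ^ 2) →
        ∑' τ, η τ ^ 2 ≤ C → ∀ τ : ℕ,
        VRSZD.ExpectedGapLE P f h
          (fun ω => VRSZD.outerIter f h γ ℓ m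
            (fun t => VRSZD.rate γ μ ^ ((m : ℝ) * (t + 1) / 2) * η t)
            (VRSZD.draws I G ω) x₀ (τ + 1))
          (VRSZD.rate γ μ ^ (m * (τ + 1)) *
            (VRSZD.gap f h x₀ + VRSZD.errConst L μ d ℓ * C))) ∧
      -- (ii)
      (∀ β : ℝ, 0 < β → ∀ τ : ℕ,
        VRSZD.ExpectedGapLE P f h
          (fun ω => VRSZD.outerIter f h γ ℓ m (fun _ => β) (VRSZD.draws I G ω) x₀ (τ + 1))
          (VRSZD.rate γ μ ^ (m * (τ + 1)) * VRSZD.gap f h x₀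
            + VRSZD.errConst L μ d ℓ * β ^ 2)) ∧
      -- (iii)
      (∀ ε₀ ε : ℝ, ε₀ < 1 → 0 < ε → ε ≤ ε₀ →
        (∀ T : ℕ, K (VRSZD.gap f h x₀) ε₀ * (1 / (m * γ * μ) * Real.log (1 / ε)) ≤ T →
          VRSZD.ExpectedGapLE P f h
            (fun ω => (VRSZD.Prog.vrszd h γ ℓ m
              (fun _ => Real.sqrt (ε / (2 * VRSZD.errConst L μ d ℓ)))
              (VRSZD.draws I G ω) x₀ T).run f)
            ε) ∧
        ∀ T : ℕ, T = ⌈K (VRSZD.gap f h x₀) ε₀ * (1 / (m * γ * μ) * Real.log (1 / ε))⌉₊ →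
          ∀ ω, ((VRSZD.Prog.vrszd h γ ℓ m
              (fun _ => Real.sqrt (ε / (2 * VRSZD.errConst L μ d ℓ)))
              (VRSZD.draws I G ω) x₀ T).evals f : ℝ)
            ≤ K' (VRSZD.gap f h x₀) ε₀ *
              ((n * d / (γ * μ * m) + b * ℓ / (γ * μ)) * Real.log (1 / ε))) := by
  refine ⟨VRSZD.iterFactor, VRSZD.evalFactor, fun D ε₀ =>
    ⟨VRSZD.iterFactor_pos D ε₀, VRSZD.evalFactor_pos D ε₀⟩, ?_⟩
  intro d n b Ω _ P _ f h L μ γ ℓ m I G x₀ hn hb hm hℓ hℓd hL hμ hγ hf hconv hprox ⟨z, hz⟩ hrpl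
    hsmooth hγμ hbatch hF₀ hS
  have hx₀ : h x₀ ≠ ⊤ := VRSZD.objective_ne_top_iff.1 hF₀
  have hgap : 0 ≤ VRSZD.gap f h x₀ := VRSZD.gap_nonneg hconv hz hx₀
  have hrate : γ * μ * (2 * m + 1) < 2 := VRSZD.mul_mul_lt_two hμ hγμ
  have hA : VRSZD.IsAdmissible f h L μ γ ℓ m b :=
    .of_stepsize_lt hn hb hm hℓ hℓd hL hμ hγ hf hconv hprox hrpl hsmooth hrate hbatch
  refine ⟨fun η C hη hsum hC τ => ?_, fun β hβ τ => ?_, fun ε₀ ε hε₀ hε hle =>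
    ⟨fun T hT => ?_, fun T hT ω => ?_⟩⟩
  · exact hA.expectedGapLE_outerIter_of_geometric hx₀ hS hη hsum hC (τ + 1)
  · exact hA.expectedGapLE_outerIter_of_const hx₀ hS hβ.ne' (τ + 1)
  · exact hA.expectedGapLE_vrszd hx₀ hS hm hL.ne' hgap hε₀ hε hle hT
  · have hmγμ : m * γ * μ ≤ 1 := by linarith [mul_pos hγ hμ]
    exact hT ▸ VRSZD.evals_vrszd_le f h _ _ x₀ hm hℓ hℓd hγ hμ hmγμ hε₀ hε hle
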